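/- **Theorem 4.7.** Let $\mathcal A$ and $\mathcal B$ be abelian categories and let $F:\mathcal A\to\mathcal B$ be an additive right exact functor. Let $(F,\mathcal B)$ be the left comma category: its objects are triples $\binom{Y}{X}_\phi$ with $Y\in\mathcal A$, $X\in\mathcal B$ and $\phi:FY\to X$ a morphism of $\mathcal B$, and its morphisms are pairs $\binom{\alpha}{\beta}$ with $\beta\phi=\phi' F(\alpha)$; it is abelian. A *complete projective resolution* in an abelian category $\mathcal C$ is an exact sequence $Q^\bullet=(\cdots\to Q^{-1}\to Q^0\to Q^1\to\cdots)$ of projective objects, indexed by $\mathbb Z$, such that $\operatorname{Hom}(Q^\bullet,P)$ is exact for every projective object $P$. An object $G$ is *Gorenstein projective* if $G\cong\operatorname{Im}(Q^{-1}\to Q^0)$ for some such $Q^\bullet$. Write $\mathcal{GP}(\mathcal C)$ for the full subcategory of Gorenstein projective objects and $\underline{\mathcal{GP}(\mathcal C)}$ for its stable category (morphisms modulo those that factor through a projective object), with its standard triangulated structure, in which the distinguished triangles are, up to isomorphism, those induced by the short exact sequences of $\mathcal C$ with all terms Gorenstein projective. Suppose that * $F$ is *perfect*: (P1) if $Q^\bullet$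 is an exact $\mathbb Z$-indexed sequence of projective objects of $\mathcal A$, then $FQ^\bullet$ is exact; (P2) if $P^\bullet$ is a complete projective resolution in $\mathcal B$ and $Q\in\mathcal A$ is projective, then $\operatorname{Hom}(P^\bullet,FQ)$ is exact; * $F$ sends projective objects to projective objects; * $\mathcal B$ is *Gorenstein*: it has enough projective and enough injective objects, the projective dimensions of its injective objects are bounded, and the injective dimensions of its projective objects are bounded. Then there is a recollement of triangulated categories of $\underline{\mathcal{GP}((F,\mathcal B))}$ relative to $\underline{\mathcal{GP}(\mathcal B)}$ and $\underline{\mathcal{GP}(\mathcal A)}$, that is, there are exact functors $$i^*,i^!:\underline{\mathcal{GP}((F,\mathcal B))}\to\underline{\mathcal{GP}(\mathcal B)},\quad i_*:\underline{\mathcal{GP}(\mathcal B)}\to\underline{\mathcal{GP}((F,\mathcal B))},\quad j^*:\underline{\mathcal{GP}((F,\mathcal B))}\to\underline{\mathcal{GP}(\mathcal A)},\quad j_!,j_*:\underline{\mathcal{GP}(\mathcal A)}\to\underline{\mathcal{GP}((F,\mathcal B))}$$ such that $(i^*,i_*)$, $(i_*,i^!)$, $(j_!,j^*)$ and $(j^*,j_*)$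 are adjoint pairs, $i_*$, $j_!$ and $j_*$ are fully faithful, $j^*i_*=0$, and for every object $W$ the units and counits extend to distinguished triangles $$j_!j^*W\to W\to i_*i^*W\to (j_!j^*W)[1],\qquad i_*i^!W\to W\to j_*j^*W\to (i_*i^!W)[1].$$ Moreover, $i^*$, $i_*$, $i^!$, $j_!$ and $j^*$ are induced respectively by the functors $\binom{Y}{X}_\phi\mapsto\operatorname{Coker}\phi$, $X\mapsto\binom{0}{X}$, $\binom{Y}{X}_\phi\mapsto X$, $Y\mapsto\binom{Y}{FY}_{\mathrm{id}}$ and $\binom{Y}{X}_\phi\mapsto Y$, all of which preserve Gorenstein projective objects. For every $Y\in\mathcal{GP}(\mathcal A)$ there is a short exact sequence $0\to FY\xrightarrow{\phi}P\to G\to0$ in $\mathcal B$ with $P$ projective and $G$ Gorenstein projective; for every such sequence $\binom{Y}{P}_\phi$ is Gorenstein projective and is isomorphic to $j_*Y$ in the stable category, naturally with respect to all morphisms between objects $\binom{Y}{P}_\phi$ of this kind. -/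

import Mathlib

open CategoryTheory CategoryTheory.Limits CategoryTheory.Pretriangulated
open scoped ZeroObject

universe v v₁ v₂ v₃ u u₁ u₂ u₃

noncomputable section

namespace GorensteinComma

section GorensteinProjective

variable {C : Type u} [Category.{v} C] [Abelian C]

/-- The complex of abelian groups `Hom(K, X)` is exact: every morphism `K.X n ⟶ X` killed by
the incoming differential factors through the outgoing one. -/
def HomExact (K : CochainComplex C ℤ) (X : C) : Prop :=
  ∀ (n : ℤ) (f : K.X n ⟶ X), K.d (n - 1) n ≫ f = 0 →
    ∃ g : K.X (n + 1) ⟶ X, K.d n (n + 1) ≫ g = f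

/-- A complete projective resolution: an exact `ℤ`-indexed sequence of projective objects which
remains exact under `Hom(-, P)` for every projective object `P`. -/
structure IsCompleteProjectiveResolution (K : CochainComplex C ℤ) : Prop where
  projective : ∀ n : ℤ, Projective (K.X n)
  acyclic : K.Acyclic
  homExact : ∀ P : C, Projective P → HomExact K P

variable (C) in
/-- Gorenstein projective objects, as a property of objects of `C`. -/
def GP : ObjectProperty C := fun G =>
  ∃ K : CochainComplex C ℤ, IsCompleteProjectiveResolution K ∧
    Nonempty (G ≅ Abelian.image (K.d (-1) 0))

lemma GP_of_isZero {Z : C} (hZ : IsZero Z) : GP C Z := by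
  have h0 : IsZero (0 : CochainComplex C ℤ) := isZero_zero _
  have hX : ∀ n, IsZero ((0 : CochainComplex C ℤ).X n) := fun n =>
    (HomologicalComplex.eval C (ComplexShape.up ℤ) n).map_isZero h0
  refine ⟨0, ⟨fun n => ?_, fun n => ?_, fun P _ n f _ => ⟨0, (hX n).eq_of_src _ _⟩⟩,
    ⟨hZ.iso ?_⟩⟩
  · exact ⟨fun f e _ => ⟨0, (hX n).eq_of_src _ _⟩⟩
  · exact ShortComplex.exact_of_isZero_X₂ _ (hX n)
  · exact IsZero.of_mono (Abelian.image.ι _) (hX 0)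

end GorensteinProjective

section Stable

variable (C : Type u) [Category.{v} C] [Abelian C]

/-- Two parallel morphisms between Gorenstein projective objects are identified when their
difference factors through a projective object. -/
def stableRel : HomRel (GP C).FullSubcategory := fun X Y f g =>
  ∃ (P : C) (_ : Projective P) (a : X.obj ⟶ P) (b : P ⟶ Y.obj), f.hom - g.hom = a ≫ b

instance : Congruence (stableRel C) where
  equivalence :=
    { refl := fun f => ⟨0, inferInstance, 0, 0, by simp⟩
      symm := by
        rintro f g ⟨P, hP, a, b, h⟩
        exact ⟨P, hP, -a, b, by rw [Preadditive.neg_comp, ← h, neg_sub]⟩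
      trans := by
        rintro f g k ⟨P, hP, a, b, h⟩ ⟨Q, hQ, c, d, h'⟩
        exact ⟨P ⊞ Q, inferInstance, biprod.lift a c, biprod.desc b d, by
          rw [biprod.lift_desc, ← h, ← h', sub_add_sub_cancel]⟩ }
  comp_left := by
    rintro X Y Z f g g' ⟨P, hP, a, b, h⟩
    exact ⟨P, hP, f.hom ≫ a, b, by
      rw [Category.assoc, ← h, Preadditive.comp_sub]; rfl⟩
  comp_right := by
    rintro X Y Z f f' g ⟨P, hP, a, b, h⟩
    exact ⟨P, hP, a, b ≫ g.hom, by
      rw [← Category.assoc, ← h, Preadditive.sub_comp]; rfl⟩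

lemma stableRel_add ⦃X Y : (GP C).FullSubcategory⦄ (f₁ f₂ g₁ g₂ : X ⟶ Y)
    (hf : stableRel C f₁ f₂) (hg : stableRel C g₁ g₂) :
    stableRel C (f₁ + g₁) (f₂ + g₂) := by
  obtain ⟨P, hP, a, b, h⟩ := hf
  obtain ⟨Q, hQ, c, d, h'⟩ := hg
  refine ⟨P ⊞ Q, inferInstance, biprod.lift a c, biprod.desc b d, ?_⟩
  rw [biprod.lift_desc, ← h, ← h']
  change (f₁.hom + g₁.hom) - (f₂.hom + g₂.hom) = _
  abel

/-- The stable category of Gorenstein projective objects modulo projective objects. -/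
def StableGP : Type u := Quotient (stableRel C)

instance : Category.{v} (StableGP C) := inferInstanceAs (Category (Quotient (stableRel C)))

instance : Preadditive (StableGP C) := Quotient.preadditive (stableRel C) (stableRel_add C)

/-- The canonical functor from Gorenstein projective objects to their stable category. -/
def toStable : (GP C).FullSubcategory ⥤ StableGP C := Quotient.functor (stableRel C)

instance : (toStable C).Additive := Quotient.functor_additive (stableRel C) (stableRel_add C)

instance : HasZeroObject (StableGP C) := by
  refine ⟨(toStable C).obj ⟨0, GP_of_isZero (isZero_zero C)⟩, (IsZero.iff_id_eq_zero _).2 ?_⟩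
  rw [← (toStable C).map_id, ← (toStable C).map_zero]
  congr 1
  exact ObjectProperty.hom_ext _ ((isZero_zero C).eq_of_src _ _)

/-- The triangulated structure of the stable category coming from the Frobenius category of
Gorenstein projective objects. It consists of a shift and a class of distinguished triangles
satisfying the axioms of a triangulated category, together with connecting morphisms
`S.X₃ ⟶ S.X₁⟦1⟧` in the stable category, natural in the short exact sequence `S` of Gorenstein
projective objects, such that the distinguished triangles are exactly those isomorphic to
`S.X₁ ⟶ S.X₂ ⟶ S.X₃ ⟶ S.X₁⟦1⟧` for some `S`. These requirements determine the structure up to a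
canonical isomorphism of shift functors: when `S.X₂` is projective, the connecting morphism
identifies the cosyzygy `S.X₃` with `S.X₁⟦1⟧`, and the other connecting morphisms follow from
these by naturality. -/
class StableTriangulation where
  [shift : HasShift (StableGP C) ℤ]
  [shift_additive : ∀ n : ℤ, (shiftFunctor (StableGP C) n).Additive]
  [pretriangulated : Pretriangulated (StableGP C)]
  [isTriangulated : IsTriangulated (StableGP C)]
  /-- the connecting morphism of a short exact sequence -/
  δ (S : ShortComplex (GP C).FullSubcategory) (hS : (S.map (GP C).ι).ShortExact) :
    (toStable C).obj S.X₃ ⟶ ((toStable C).obj S.X₁)⟦(1 : ℤ)⟧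
  δ_naturality {S S' : ShortComplex (GP C).FullSubcategory}
    (hS : (S.map (GP C).ι).ShortExact) (hS' : (S'.map (GP C).ι).ShortExact) (φ : S ⟶ S') :
    (toStable C).map φ.τ₃ ≫ δ S' hS' = δ S hS ≫ ((toStable C).map φ.τ₁)⟦(1 : ℤ)⟧'
  distinguished_iff (T : Triangle (StableGP C)) :
    T ∈ distTriang (StableGP C) ↔
      ∃ (S : ShortComplex (GP C).FullSubcategory) (hS : (S.map (GP C).ι).ShortExact),
        Nonempty (T ≅ Triangle.mk ((toStable C).map S.f) ((toStable C).map S.g) (δ S hS))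

attribute [reducible, instance] StableTriangulation.shift StableTriangulation.pretriangulated

attribute [instance] StableTriangulation.shift_additive StableTriangulation.isTriangulated

end Stable

section Induced

variable {C : Type u₁} [Category.{v₁} C] [Abelian C] {D : Type u₂} [Category.{v₂} D] [Abelian D]

/-- The restriction of a functor to Gorenstein projective objects, when it preserves them. -/
def restrictGP (φ : C ⥤ D) (h : ∀ X : C, GP C X → GP D (φ.obj X)) :
    (GP C).FullSubcategory ⥤ (GP D).FullSubcategory :=
  (GP D).lift ((GP C).ι ⋙ φ) (fun X => h _ X.property)

/-- `Φ` is the functor between stable categories induced by `φ`: the functor `φ` preserves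
Gorenstein projective objects and `Φ` acts, up to natural isomorphism, by `φ` on objects and
morphisms. -/
def IsInducedBy (Φ : StableGP C ⥤ StableGP D) (φ : C ⥤ D) : Prop :=
  ∃ h : ∀ X : C, GP C X → GP D (φ.obj X),
    Nonempty (toStable C ⋙ Φ ≅ restrictGP φ h ⋙ toStable D)

end Induced

section Recollement

variable (C' : Type u₁) [Category.{v₁} C'] [Preadditive C'] [HasZeroObject C'] [HasShift C' ℤ]
  [∀ n : ℤ, (shiftFunctor C' n).Additive] [Pretriangulated C']
  (C : Type u₂) [Category.{v₂} C] [Preadditive C] [HasZeroObject C] [HasShift C ℤ]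
  [∀ n : ℤ, (shiftFunctor C n).Additive] [Pretriangulated C]
  (C'' : Type u₃) [Category.{v₃} C''] [Preadditive C''] [HasZeroObject C''] [HasShift C'' ℤ]
  [∀ n : ℤ, (shiftFunctor C'' n).Additive] [Pretriangulated C'']

/-- A recollement of `C` relative to `C'` and `C''`; the six functors `i^*`, `i_*`, `i^!`, `j_!`,
`j^*`, `j_*` are exact (triangulated). -/
structure Recollement where
  /-- `i^*` -/
  iUpperStar : C ⥤ C'
  /-- `i_*` -/
  iLowerStar : C' ⥤ C
  /-- `i^!` -/
  iUpperShriek : C ⥤ C'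
  /-- `j_!` -/
  jLowerShriek : C'' ⥤ C
  /-- `j^*` -/
  jUpperStar : C ⥤ C''
  /-- `j_*` -/
  jLowerStar : C'' ⥤ C
  [iUpperStar_commShift : iUpperStar.CommShift ℤ]
  [iLowerStar_commShift : iLowerStar.CommShift ℤ]
  [iUpperShriek_commShift : iUpperShriek.CommShift ℤ]
  [jLowerShriek_commShift : jLowerShriek.CommShift ℤ]
  [jUpperStar_commShift : jUpperStar.CommShift ℤ]
  [jLowerStar_commShift : jLowerStar.CommShift ℤ]
  iUpperStar_isTriangulated : iUpperStar.IsTriangulated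
  iLowerStar_isTriangulated : iLowerStar.IsTriangulated
  iUpperShriek_isTriangulated : iUpperShriek.IsTriangulated
  jLowerShriek_isTriangulated : jLowerShriek.IsTriangulated
  jUpperStar_isTriangulated : jUpperStar.IsTriangulated
  jLowerStar_isTriangulated : jLowerStar.IsTriangulated
  /-- `(i^*, i_*)` is an adjoint pair -/
  adjUpperStarI : iUpperStar ⊣ iLowerStar
  /-- `(i_*, i^!)` is an adjoint pair -/
  adjShriekI : iLowerStar ⊣ iUpperShriek
  /-- `(j_!, j^*)` is an adjoint pair -/
  adjShriekJ : jLowerShriek ⊣ jUpperStar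
  /-- `(j^*, j_*)` is an adjoint pair -/
  adjUpperStarJ : jUpperStar ⊣ jLowerStar
  iLowerStar_full : iLowerStar.Full
  iLowerStar_faithful : iLowerStar.Faithful
  jLowerShriek_full : jLowerShriek.Full
  jLowerShriek_faithful : jLowerShriek.Faithful
  jLowerStar_full : jLowerStar.Full
  jLowerStar_faithful : jLowerStar.Faithful
  jUpperStar_iLowerStar : ∀ X : C', IsZero (jUpperStar.obj (iLowerStar.obj X))
  triangle_jShriek_iStar : ∀ X : C,
    ∃ w : iLowerStar.obj (iUpperStar.obj X) ⟶ (jLowerShriek.obj (jUpperStar.obj X))⟦(1 : ℤ)⟧,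
      Triangle.mk (adjShriekJ.counit.app X) (adjUpperStarI.unit.app X) w ∈ distTriang C
  triangle_iShriek_jStar : ∀ X : C,
    ∃ w : jLowerStar.obj (jUpperStar.obj X) ⟶ (iLowerStar.obj (iUpperShriek.obj X))⟦(1 : ℤ)⟧,
      Triangle.mk (adjShriekI.counit.app X) (adjUpperStarJ.unit.app X) w ∈ distTriang C

end Recollement

section Gorenstein

variable (B : Type u) [Category.{v} B] [Abelian B]

/-- Gorenstein abelian categories: there are enough projectives and injectives, the projective
dimension of the injective objects is bounded and so is the injective dimension of the
projective objects. -/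
structure IsGorenstein : Prop where
  enoughProjectives : EnoughProjectives B
  enoughInjectives : EnoughInjectives B
  projectiveDimension : ∃ n : ℕ, ∀ I : B, Injective I → HasProjectiveDimensionLE I n
  injectiveDimension : ∃ n : ℕ, ∀ P : B, Projective P → HasInjectiveDimensionLE P n

end Gorenstein

section LeftComma

variable {A : Type u₁} [Category.{v₁} A] [Abelian A] {B : Type u₂} [Category.{v₂} B] [Abelian B]

/-- Perfect functors. -/
structure IsPerfect (F : A ⥤ B) [F.Additive] : Prop where
  /-- `F` keeps exact sequences of projective objects exact -/
  acyclic_map : ∀ Q : CochainComplex A ℤ, (∀ n : ℤ, Projective (Q.X n)) → Q.Acyclic →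
    ((F.mapHomologicalComplex (ComplexShape.up ℤ)).obj Q).Acyclic
  /-- complete projective resolutions stay exact under `Hom(-, F Q)` for `Q` projective -/
  homExact : ∀ P : CochainComplex B ℤ, IsCompleteProjectiveResolution P →
    ∀ Q : A, Projective Q → HomExact P (F.obj Q)

/-- The left comma category `(F, B)`: objects are morphisms `F Y ⟶ X`, where `Y` is the component
`left` and `X` is the component `right`. -/
abbrev LeftComma (F : A ⥤ B) := Comma F (𝟭 B)

section Abelian

variable (F : A ⥤ B)

lemma preservesLimitsOfShape_fst (J : Type) [SmallCategory J] [FinCategory J] :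
    PreservesLimitsOfShape J (Comma.fst F (𝟭 B)) where
  preservesLimit :=
    preservesLimit_of_preserves_limit_cone
      (Comma.coneOfPreservesIsLimit _ (limit.isLimit _) (limit.isLimit _))
      (limit.isLimit _)

lemma preservesLimitsOfShape_snd (J : Type) [SmallCategory J] [FinCategory J] :
    PreservesLimitsOfShape J (Comma.snd F (𝟭 B)) where
  preservesLimit :=
    preservesLimit_of_preserves_limit_cone
      (Comma.coneOfPreservesIsLimit _ (limit.isLimit _) (limit.isLimit _))
      (limit.isLimit _)

lemma isIso_of_components {X Y : LeftComma F} (f : X ⟶ Y) (h₁ : IsIso f.left)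
    (h₂ : IsIso f.right) : IsIso f :=
  (Comma.isoMk (asIso f.left) (asIso f.right) f.w).isIso_hom

variable [F.Additive] [PreservesFiniteColimits F]

lemma isIso_coimageImageComparison {X Y : LeftComma F} (f : X ⟶ Y) :
    IsIso (Abelian.coimageImageComparison f) := by
  have := preservesLimitsOfShape_fst F WalkingParallelPair
  have := preservesLimitsOfShape_snd F WalkingParallelPair
  apply isIso_of_components
  · exact ((MorphismProperty.isomorphisms A).arrow_mk_iso_iff
      (Abelian.PreservesCoimageImageComparison.iso (Comma.fst F (𝟭 B)) f)).2
      (inferInstanceAs (IsIso (Abelian.coimageImageComparison _)))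
  · exact ((MorphismProperty.isomorphisms B).arrow_mk_iso_iff
      (Abelian.PreservesCoimageImageComparison.iso (Comma.snd F (𝟭 B)) f)).2
      (inferInstanceAs (IsIso (Abelian.coimageImageComparison _)))

/-- The left comma category of a right exact functor is abelian. -/
instance : Abelian (LeftComma F) :=
  have : ∀ {X Y : LeftComma F} (f : X ⟶ Y), IsIso (Abelian.coimageImageComparison f) :=
    isIso_coimageImageComparison F
  Abelian.ofCoimageImageComparisonIsIso

end Abelian

variable (F : A ⥤ B)

/-- The functor `(Y, X)_φ ↦ Coker φ`. -/
@[simps]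
def cokerFunctor : LeftComma F ⥤ B where
  obj W := cokernel W.hom
  map {W W'} f := cokernel.map W.hom W'.hom (F.map f.left) f.right f.w.symm

/-- The functor `X ↦ (0, X)`. -/
@[simps]
def zeroLeftFunctor : B ⥤ LeftComma F where
  obj X := { left := 0, right := X, hom := 0 }
  map f := { left := 0, right := f }

/-- The functor `Y ↦ (Y, F Y)` with the identity as structure morphism. -/
@[simps]
def freeFunctor : A ⥤ LeftComma F where
  obj Y := { left := Y, right := F.obj Y, hom := 𝟙 _ }
  map f := { left := f, right := F.map f }

/-- The objects `(Y, P)_φ` of the left comma category for which `Y` is Gorenstein projective and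
`φ` fits in a short exact sequence `0 ⟶ F Y ⟶ P ⟶ G ⟶ 0` with `P` projective and `G` Gorenstein
projective. -/
def IsProjectiveCopresentation : ObjectProperty (LeftComma F) := fun W =>
  GP A W.left ∧ Mono W.hom ∧ Projective W.right ∧ GP B (cokernel W.hom)

/-- The functor `(Y, P)_φ ↦ Y` on the objects of `IsProjectiveCopresentation`. -/
def copresentationLeft :
    (IsProjectiveCopresentation F).FullSubcategory ⥤ (GP A).FullSubcategory :=
  (GP A).lift ((IsProjectiveCopresentation F).ι ⋙ Comma.fst F (𝟭 B)) (fun W => W.property.1)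

variable [F.Additive] [PreservesFiniteColimits F]

/-- `Ψ` sends a Gorenstein projective object `Y` to `(Y, P)_φ` for any short exact sequence
`0 ⟶ F Y ⟶ P ⟶ G ⟶ 0` with `P` projective and `G` Gorenstein projective, and a morphism `g` to any
morphism of the comma category with first component `g`: such sequences exist for every `Y`, all
these `(Y, P)_φ` are Gorenstein projective, and `(Y, P)_φ ≅ Ψ Y` in the stable category,
naturally in `(Y, P)_φ`. -/
def IsGivenByCopresentations (Ψ : StableGP A ⥤ StableGP (LeftComma F)) : Prop :=
  (∀ Y : A, GP A Y → ∃ (P : B) (φ : F.obj Y ⟶ P),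
    IsProjectiveCopresentation F { left := Y, right := P, hom := φ }) ∧
  ∃ h : IsProjectiveCopresentation F ≤ GP (LeftComma F),
    Nonempty (copresentationLeft F ⋙ toStable A ⋙ Ψ ≅
      ObjectProperty.ιOfLE h ⋙ toStable (LeftComma F))

end LeftComma

end GorensteinComma

end

open GorensteinComma

/-!
The stable category of Gorenstein projective objects is triangulated by means of complete
projective resolutions: the shift of `Z⁰K` is `Z¹K`, and a short exact sequence of Gorenstein
projective objects lifts to a degreewise split exact sequence of complete resolutions, which gives
its connecting morphism.

A functor that preserves complete projective resolutions induces an exact functor between stable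
categories, and an adjunction between two such functors induces an adjunction. The functors
`i^*`, `i_*`, `i^!`, `j_!` and `j^*` are of this kind. For `(Y, X)_φ` Gorenstein projective `φ` is
a monomorphism with Gorenstein projective cokernel, so that a morphism `FY ⟶ P` with `P`
projective extends along `φ` to `X`. Hence morphisms from `(Y, X)` to a copresentation `(Y', P)`
are stably the same as morphisms from `Y` to `Y'`, which gives the right adjoint `j_*` of `j^*`.

The triangle of `j_!` and `i^*` comes from `0 ⟶ (Y, FY) ⟶ (Y, X) ⟶ (0, Coker φ) ⟶ 0`, the triangle
of `i_*` and `j_*` from `0 ⟶ (0, X) ⟶ (Y, X ⊞ P) ⟶ (Y, P) ⟶ 0`, where `(Y, X ⊞ P)` is stably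
isomorphic to `(Y, X)`.
-/

noncomputable section

namespace GorensteinComma

lemma exists_int_family {α : ℤ → Type*} (R : ∀ n, α n → α (n + 1) → Prop) (m : ℤ) (x₀ : α m)
    (hr : ∀ n (x : α n), ∃ y, R n x y) (hl : ∀ n (y : α (n + 1)), ∃ x, R n x y) :
    ∃ f : ∀ n, α n, f m = x₀ ∧ ∀ n, R n (f n) (f (n + 1)) := by
  choose r hr using hr
  choose l hl using hl
  refine ⟨fun n => Int.inductionOn' (motive := α) n m x₀ (fun k _ x => r k x)
    (fun k _ x => l (k - 1) (cast (by rw [sub_add_cancel]) x)), Int.inductionOn'_self, fun n => ?_⟩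
  by_cases h : m ≤ n
  · dsimp only
    rw [Int.inductionOn'_add_one h]
    exact hr _ _
  · obtain ⟨k, rfl⟩ : ∃ k, n = k - 1 := ⟨n + 1, by lia⟩
    dsimp only
    rw [Int.inductionOn'_sub_one (by lia)]
    convert hl (k - 1) _
    rw [eq_cast_iff_heq]
    congr 1
    all_goals simp

section Cycles

variable {C : Type u} [Category.{v} C] [Abelian C] {K : CochainComplex C ℤ}

open HomologicalComplex

@[simp]
lemma iCycles_toCycles (K : CochainComplex C ℤ) (i j : ℤ) :
    K.iCycles i ≫ K.toCycles i j = 0 := by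
  rw [← cancel_mono (K.iCycles j)]
  simp

lemma epi_toCycles (hK : K.Acyclic) (i j : ℤ) (hij : i + 1 = j) : Epi (K.toCycles i j) := by
  obtain rfl : i = (ComplexShape.up ℤ).prev j := by simp only [CochainComplex.prev]; lia
  exact (ShortComplex.exact_iff_epi_toCycles _).1 (hK j)

/-- The short complex `Zⁱ(K) ⟶ Kⁱ ⟶ Zʲ(K)`, where `j` is meant to be `i + 1`. -/
def cyclesShortComplex (K : CochainComplex C ℤ) (i j : ℤ) : ShortComplex C where
  X₁ := K.cycles i
  X₂ := K.X i
  X₃ := K.cycles j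
  f := K.iCycles i
  g := K.toCycles i j
  zero := iCycles_toCycles K i j

lemma cyclesShortComplex_shortExact (hK : K.Acyclic) (i j : ℤ) (hij : i + 1 = j) :
    (cyclesShortComplex K i j).ShortExact where
  exact := by
    have hex : (ShortComplex.mk (K.iCycles i) (K.d i j) (K.iCycles_d i j)).Exact :=
      ShortComplex.exact_of_f_is_kernel _ (K.cyclesIsKernel i j (by simp [hij]))
    let φ : cyclesShortComplex K i j ⟶ ShortComplex.mk (K.iCycles i) (K.d i j) (K.iCycles_d i j) :=
      { τ₁ := 𝟙 (K.cycles i)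
        τ₂ := 𝟙 (K.X i)
        τ₃ := K.iCycles j
        comm₁₂ := (Category.id_comp _).trans (Category.comp_id _).symm
        comm₂₃ := (Category.id_comp _).trans (K.toCycles_i i j).symm }
    have : Epi φ.τ₁ := inferInstanceAs (Epi (𝟙 _))
    have : IsIso φ.τ₂ := inferInstanceAs (IsIso (𝟙 _))
    have : Mono φ.τ₃ := inferInstanceAs (Mono (K.iCycles j))
    exact (ShortComplex.exact_iff_of_epi_of_isIso_of_mono φ).2 hex
  mono_f := inferInstanceAs (Mono (K.iCycles i))
  epi_g := epi_toCycles hK i j hij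

lemma exists_toCycles_comp_eq (hK : K.Acyclic) (i j : ℤ) (hij : i + 1 = j) {X : C}
    (f : K.X i ⟶ X) (hf : K.iCycles i ≫ f = 0) :
    ∃ g : K.cycles j ⟶ X, K.toCycles i j ≫ g = f :=
  have hS := cyclesShortComplex_shortExact hK i j hij
  have := hS.epi_g
  ⟨hS.exact.desc f hf, hS.exact.g_desc f hf⟩

lemma exists_comp_toCycles_eq (hK : K.Acyclic) (i j : ℤ) (hij : i + 1 = j) {P : C} [Projective P]
    (f : P ⟶ K.cycles j) : ∃ g : P ⟶ K.X i, g ≫ K.toCycles i j = f :=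
  have := epi_toCycles hK i j hij
  ⟨Projective.factorThru f (K.toCycles i j), Projective.factorThru_comp _ _⟩

/-- The identification of `Zⁱ` of the complex shifted by `n` with `Zⁿ⁺ⁱ`. -/
def cyclesShiftIso (K : CochainComplex C ℤ) (n i j : ℤ) (h : n + i = j) :
    (K⟦n⟧).cycles i ≅ K.cycles j :=
  ShortComplex.cyclesMapIso ((CochainComplex.shiftShortComplexFunctorIso C n i j h).app K)

lemma cyclesShiftIso_hom_naturality {K L : CochainComplex C ℤ} (f : K ⟶ L) (n i j : ℤ)
    (h : n + i = j) :
    cyclesMap (f⟦n⟧') i ≫ (cyclesShiftIso L n i j h).hom =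
      (cyclesShiftIso K n i j h).hom ≫ cyclesMap f j :=
  (ShortComplex.cyclesMap_comp _ _).symm.trans
    ((congrArg ShortComplex.cyclesMap
      ((CochainComplex.shiftShortComplexFunctorIso C n i j h).hom.naturality f)).trans
        (ShortComplex.cyclesMap_comp _ _))

lemma cyclesShiftIso_hom_iCycles (K : CochainComplex C ℤ) (n i j : ℤ) (h : n + i = j) :
    (cyclesShiftIso K n i j h).hom ≫ K.iCycles j =
      (K⟦n⟧).iCycles i ≫ (K.shiftFunctorObjXIso n i j (by lia)).hom := by
  exact (ShortComplex.cyclesMap_i _).trans (congrArg ((K⟦n⟧).iCycles i ≫ ·)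
    (CochainComplex.shiftShortComplexFunctorIso_hom_app_τ₂ C n i j h K))

lemma acyclic_shift (hK : K.Acyclic) (n : ℤ) : (K⟦n⟧).Acyclic := fun i =>
  (ShortComplex.exact_iff_of_iso
    ((CochainComplex.shiftShortComplexFunctorIso C n i (n + i) rfl).app K)).2 (hK (n + i))

end Cycles

section GorensteinProjective

variable {C : Type u} [Category.{v} C] [Abelian C] {K : CochainComplex C ℤ}

open HomologicalComplex

lemma HomExact.exists_desc {X : C} (h : HomExact K X) (i j k : ℤ) (hij : i + 1 = j)
    (hjk : j + 1 = k) (f : K.X j ⟶ X) (hf : K.d i j ≫ f = 0) :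
    ∃ g : K.X k ⟶ X, K.d j k ≫ g = f := by
  obtain rfl := hjk
  obtain rfl : i = j - 1 := by lia
  exact h j f hf

lemma HomExact.exists_extension {X : C} (h : HomExact K X) (hK : K.Acyclic) (n : ℤ)
    (f : K.cycles n ⟶ X) : ∃ g : K.X n ⟶ X, K.iCycles n ≫ g = f := by
  obtain ⟨m, rfl⟩ : ∃ m, n = m + 1 := ⟨n - 1, by lia⟩
  have := epi_toCycles hK m (m + 1) rfl
  obtain ⟨g, hg⟩ := h m (K.toCycles m (m + 1) ≫ f) (by simp)
  refine ⟨g, ?_⟩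
  rw [← cancel_epi (K.toCycles m (m + 1)), ← hg, toCycles_i_assoc]

lemma HomExact.shift {X : C} (h : HomExact K X) (n : ℤ) : HomExact (K⟦n⟧) X := by
  intro m (f : K.X (m + n) ⟶ X) hf
  have hf' : (n.negOnePow • K.d (m - 1 + n) (m + n)) ≫ f = 0 := hf
  rw [Linear.units_smul_comp, smul_eq_zero_iff_eq] at hf'
  obtain ⟨g, hg⟩ := h.exists_desc (m - 1 + n) (m + n) (m + 1 + n) (by lia) (by lia) f hf'
  refine ⟨n.negOnePow • g, ?_⟩
  change (n.negOnePow • K.d (m + n) (m + 1 + n)) ≫ (n.negOnePow • g) = f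
  rw [Linear.units_smul_comp, Linear.comp_units_smul, smul_smul, Int.units_mul_self, one_smul, hg]

lemma IsCompleteProjectiveResolution.shift (hK : IsCompleteProjectiveResolution K) (n : ℤ) :
    IsCompleteProjectiveResolution (K⟦n⟧) where
  projective m := hK.projective (m + n)
  acyclic := acyclic_shift hK.acyclic n
  homExact P hP := (hK.homExact P hP).shift n

lemma nonempty_image_d_iso_cycles (hK : K.Acyclic) (i j : ℤ) (hij : i + 1 = j) :
    Nonempty (Abelian.image (K.d i j) ≅ K.cycles j) :=
  have := epi_toCycles hK i j hij
  have := strongEpi_of_epi (K.toCycles i j)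
  ⟨Abelian.imageIsoImage _ ≪≫ (image.isoStrongEpiMono _ _ (K.toCycles_i i j)).symm⟩

instance GP_isClosedUnderIsomorphisms : (GP C).IsClosedUnderIsomorphisms where
  of_iso := fun e ⟨K, hK, ⟨e'⟩⟩ => ⟨K, hK, ⟨e.symm ≪≫ e'⟩⟩

lemma IsCompleteProjectiveResolution.GP_cycles (hK : IsCompleteProjectiveResolution K) (n : ℤ) :
    GP C (K.cycles n) :=
  ⟨K⟦n⟧, hK.shift n, ⟨(cyclesShiftIso K n 0 n (add_zero n)).symm ≪≫
    (nonempty_image_d_iso_cycles (hK.shift n).acyclic (-1) 0 rfl).some.symm⟩⟩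

lemma GP_iff_exists_iso_cycles (G : C) (n : ℤ) :
    GP C G ↔ ∃ K : CochainComplex C ℤ, IsCompleteProjectiveResolution K ∧
      Nonempty (G ≅ K.cycles n) :=
  ⟨fun ⟨K, hK, ⟨e⟩⟩ => ⟨K⟦-n⟧, hK.shift (-n),
    ⟨e ≪≫ (nonempty_image_d_iso_cycles hK.acyclic (-1) 0 rfl).some ≪≫
      (cyclesShiftIso K (-n) n 0 (neg_add_cancel n)).symm⟩⟩,
    fun ⟨_, hK, ⟨e⟩⟩ => (GP C).prop_of_iso e.symm (hK.GP_cycles n)⟩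

lemma GP.exists_embedding {X : C} (hX : GP C X) :
    ∃ (P : C) (ι : X ⟶ P), Projective P ∧ Mono ι ∧ GP C (cokernel ι) := by
  obtain ⟨K, hK, ⟨e⟩⟩ := (GP_iff_exists_iso_cycles _ 0).1 hX
  have hS := cyclesShortComplex_shortExact hK.acyclic 0 1 rfl
  have := hS.epi_g
  refine ⟨K.X 0, e.hom ≫ K.iCycles 0, hK.projective 0, inferInstance, ?_⟩
  exact (GP C).prop_of_iso ((cokernelEpiComp e.hom (K.iCycles 0) ≪≫
    IsColimit.coconePointUniqueUpToIso (colimit.isColimit _) hS.gIsCokernel).symm)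
    (hK.GP_cycles 1)

/-- The pushout of a short complex along a morphism from its first object. -/
def pushoutShortComplex (S : ShortComplex C) {P : C} (f : S.X₁ ⟶ P) : ShortComplex C where
  X₁ := P
  X₂ := pushout S.f f
  X₃ := S.X₃
  f := pushout.inr S.f f
  g := pushout.desc S.g 0 (by rw [S.zero, comp_zero])
  zero := pushout.inr_desc _ _ _

lemma pushoutShortComplex_shortExact {S : ShortComplex C} (hS : S.ShortExact) {P : C}
    (f : S.X₁ ⟶ P) : (pushoutShortComplex S f).ShortExact :=
  have := hS.mono_f
  have := hS.epi_g
  have : Epi (pushoutShortComplex S f).g :=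
    (epi_of_epi_fac (pushout.inl_desc S.g 0 _) : Epi (pushout.desc (g := f) S.g 0 _))
  { exact := ShortComplex.exact_of_g_is_cokernel _ <|
      CokernelCofork.IsColimit.ofπ' _ _ fun {Z} (k : pushout S.f f ⟶ Z)
          (hk : pushout.inr S.f f ≫ k = 0) =>
        ⟨hS.exact.desc (pushout.inl S.f f ≫ k) (by rw [pushout.condition_assoc, hk, comp_zero]),
          pushout.hom_ext ((pushout.inl_desc_assoc _ _ _ _).trans (hS.exact.g_desc _ _))
            ((pushout.inr_desc_assoc _ _ _ _).trans (zero_comp.trans hk.symm))⟩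
    mono_f := inferInstanceAs (Mono (pushout.inr S.f f)) }

lemma GP.exists_section {S : ShortComplex C} (hS : S.ShortExact) [Projective S.X₁]
    (h₃ : GP C S.X₃) : ∃ s : S.X₃ ⟶ S.X₂, s ≫ S.g = 𝟙 S.X₃ := by
  obtain ⟨K, hK, ⟨e⟩⟩ := (GP_iff_exists_iso_cycles _ 0).1 h₃
  have := hK.projective (-1)
  have := hS.mono_f
  have := hS.epi_g
  have := epi_toCycles hK.acyclic (-1) 0 rfl
  let l : K.X (-1) ⟶ S.X₂ := Projective.factorThru (K.toCycles (-1) 0 ≫ e.inv) S.g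
  have hl : l ≫ S.g = K.toCycles (-1) 0 ≫ e.inv := Projective.factorThru_comp _ _
  have hl' : (K.iCycles (-1) ≫ l) ≫ S.g = 0 := by
    rw [Category.assoc, hl, ← Category.assoc, iCycles_toCycles, zero_comp]
  obtain ⟨u, hu⟩ := (hK.homExact S.X₁ inferInstance).exists_extension hK.acyclic (-1)
    (hS.exact.lift _ hl')
  obtain ⟨s, hs⟩ := exists_toCycles_comp_eq hK.acyclic (-1) 0 rfl (l - u ≫ S.f) (by
    rw [Preadditive.comp_sub, ← Category.assoc, hu, hS.exact.lift_f, sub_self])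
  have hs' : s ≫ S.g = e.inv := by
    rw [← cancel_epi (K.toCycles (-1) 0), reassoc_of% hs, Preadditive.sub_comp, hl, Category.assoc,
      S.zero, comp_zero, sub_zero]
  exact ⟨e.hom ≫ s, by rw [Category.assoc, hs', e.hom_inv_id]⟩

lemma GP.exists_extension {S : ShortComplex C} (hS : S.ShortExact) (h₃ : GP C S.X₃) {P : C}
    [Projective P] (f : S.X₁ ⟶ P) : ∃ g : S.X₂ ⟶ P, S.f ≫ g = f := by
  have hT := pushoutShortComplex_shortExact hS f
  have : Projective (pushoutShortComplex S f).X₁ := inferInstanceAs (Projective P)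
  obtain ⟨s, hs⟩ := GP.exists_section hT h₃
  let σ := ShortComplex.Splitting.ofExactOfSection _ hT.exact s hs hT.mono_f
  refine ⟨pushout.inl S.f f ≫ σ.r, (pushout.condition_assoc σ.r).trans ?_⟩
  exact (congrArg (f ≫ ·) σ.f_r).trans (Category.comp_id f)

end GorensteinProjective

section ChainMaps

variable {C : Type u} [Category.{v} C] [Abelian C] {K L : CochainComplex C ℤ}

open HomologicalComplex

lemma exists_next_hom_cycles (hK : K.Acyclic) {n : ℤ} (hKL : HomExact K (L.X n))
    (a : K.cycles n ⟶ L.cycles n) :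
    ∃ (b : K.cycles (n + 1) ⟶ L.cycles (n + 1)) (g : K.X n ⟶ L.X n),
      K.iCycles n ≫ g = a ≫ L.iCycles n ∧
        g ≫ L.toCycles n (n + 1) = K.toCycles n (n + 1) ≫ b := by
  obtain ⟨g, hg⟩ := hKL.exists_extension hK n (a ≫ L.iCycles n)
  obtain ⟨b, hb⟩ := exists_toCycles_comp_eq hK n (n + 1) rfl (g ≫ L.toCycles n (n + 1)) (by
    rw [reassoc_of% hg, iCycles_toCycles, comp_zero])
  exact ⟨b, g, hg, hb.symm⟩

lemma exists_prev_hom_cycles (hL : L.Acyclic) {n : ℤ} [Projective (K.X n)]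
    (b : K.cycles (n + 1) ⟶ L.cycles (n + 1)) :
    ∃ (a : K.cycles n ⟶ L.cycles n) (g : K.X n ⟶ L.X n),
      K.iCycles n ≫ g = a ≫ L.iCycles n ∧
        g ≫ L.toCycles n (n + 1) = K.toCycles n (n + 1) ≫ b := by
  obtain ⟨g, hg⟩ := exists_comp_toCycles_eq hL n (n + 1) rfl (K.toCycles n (n + 1) ≫ b)
  have hg' : (K.iCycles n ≫ g) ≫ L.d n (n + 1) = 0 := by
    rw [← L.toCycles_i, Category.assoc, reassoc_of% hg, ← Category.assoc, iCycles_toCycles,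
      zero_comp]
  exact ⟨L.liftCycles _ (n + 1) (by simp) hg', g, (L.liftCycles_i _ _ _ _).symm, hg⟩

lemma IsCompleteProjectiveResolution.exists_hom (hK : IsCompleteProjectiveResolution K)
    (hL : IsCompleteProjectiveResolution L) (m : ℤ) (h : K.cycles m ⟶ L.cycles m) :
    ∃ f : K ⟶ L, cyclesMap f m = h := by
  obtain ⟨φ, hφ, H⟩ := exists_int_family (α := fun n => (K.cycles n ⟶ L.cycles n))
    (fun n a b => ∃ g : K.X n ⟶ L.X n, K.iCycles n ≫ g = a ≫ L.iCycles n ∧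
      g ≫ L.toCycles n (n + 1) = K.toCycles n (n + 1) ≫ b) m h
    (fun n => exists_next_hom_cycles hK.acyclic (hK.homExact _ (hL.projective n)))
    (fun n => have := hK.projective n; exists_prev_hom_cycles hL.acyclic)
  choose g hg hg' using H
  let f : K ⟶ L :=
    { f := g
      comm' := fun i j hij => by
        obtain rfl : i + 1 = j := hij
        rw [← L.toCycles_i, reassoc_of% (hg' i), ← hg, toCycles_i_assoc] }
  refine ⟨f, ?_⟩
  rw [← cancel_mono (L.iCycles m), cyclesMap_i, ← hφ]
  exact hg m

/-- `s` agrees with a null-homotopy of `f` on the cycles of degree `n + 1`. -/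
def IsNullHomotopyOnCycles (f : K ⟶ L) (n : ℤ) (s : K.X (n + 1) ⟶ L.X n) : Prop :=
  K.iCycles (n + 1) ≫ s ≫ L.d n (n + 1) = K.iCycles (n + 1) ≫ f.f (n + 1)

lemma IsNullHomotopyOnCycles.exists_next (hK : K.Acyclic) {f : K ⟶ L} {n : ℤ}
    (hKL : HomExact K (L.X (n + 1))) {s : K.X (n + 1) ⟶ L.X n}
    (hs : IsNullHomotopyOnCycles f n s) :
    ∃ t, IsNullHomotopyOnCycles f (n + 1) t ∧
      f.f (n + 1) = s ≫ L.d n (n + 1) + K.d (n + 1) (n + 1 + 1) ≫ t := by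
  obtain ⟨g, hg⟩ := exists_toCycles_comp_eq hK (n + 1) (n + 1 + 1) rfl
    (f.f (n + 1) - s ≫ L.d n (n + 1)) (by rw [Preadditive.comp_sub, hs, sub_self])
  obtain ⟨t, ht⟩ := hKL.exists_extension hK (n + 1 + 1) g
  have ht' : K.d (n + 1) (n + 1 + 1) ≫ t = f.f (n + 1) - s ≫ L.d n (n + 1) := by
    rw [← hg, ← ht, toCycles_i_assoc]
  have := epi_toCycles hK (n + 1) (n + 1 + 1) rfl
  refine ⟨t, ?_, by rw [ht', add_sub_cancel]⟩
  rw [IsNullHomotopyOnCycles, ← cancel_epi (K.toCycles (n + 1) (n + 1 + 1)), toCycles_i_assoc,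
    toCycles_i_assoc, reassoc_of% ht', Preadditive.sub_comp, f.comm, Category.assoc, L.d_comp_d,
    comp_zero, sub_zero]

lemma IsNullHomotopyOnCycles.exists_prev (hL : L.Acyclic) {f : K ⟶ L} {n : ℤ}
    [Projective (K.X (n + 1))] {t : K.X (n + 1 + 1) ⟶ L.X (n + 1)}
    (ht : IsNullHomotopyOnCycles f (n + 1) t) :
    ∃ s, IsNullHomotopyOnCycles f n s ∧
      f.f (n + 1) = s ≫ L.d n (n + 1) + K.d (n + 1) (n + 1 + 1) ≫ t := by
  have h0 : (f.f (n + 1) - K.d (n + 1) (n + 1 + 1) ≫ t) ≫ L.d (n + 1) (n + 1 + 1) = 0 := by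
    have h := K.toCycles (n + 1) (n + 1 + 1) ≫= ht
    simp only [toCycles_i_assoc] at h
    rw [Preadditive.sub_comp, f.comm, Category.assoc, h, sub_self]
  obtain ⟨s, hs⟩ := exists_comp_toCycles_eq hL n (n + 1) rfl
    (L.liftCycles _ (n + 1 + 1) (by simp) h0)
  have hs' : s ≫ L.d n (n + 1) = f.f (n + 1) - K.d (n + 1) (n + 1 + 1) ≫ t := by
    rw [← L.toCycles_i, reassoc_of% hs, liftCycles_i]
  refine ⟨s, ?_, by rw [hs', sub_add_cancel]⟩
  rw [IsNullHomotopyOnCycles, hs', Preadditive.comp_sub, iCycles_d_assoc, zero_comp, sub_zero]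

lemma IsCompleteProjectiveResolution.nonempty_homotopy (hK : IsCompleteProjectiveResolution K)
    (hL : IsCompleteProjectiveResolution L) {f : K ⟶ L} {m : ℤ} {s : K.X (m + 1) ⟶ L.X m}
    (hs : IsNullHomotopyOnCycles f m s) : Nonempty (Homotopy f 0) := by
  obtain ⟨σ, -, H⟩ := exists_int_family (α := fun n => { s // IsNullHomotopyOnCycles f n s })
    (fun n s t => f.f (n + 1) = s.1 ≫ L.d n (n + 1) + K.d (n + 1) (n + 1 + 1) ≫ t.1) m ⟨s, hs⟩
    (fun n s =>
      have ⟨t, ht, h⟩ := s.2.exists_next hK.acyclic (hK.homExact _ (hL.projective (n + 1)))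
      ⟨⟨t, ht⟩, h⟩)
    (fun n t =>
      have := hK.projective (n + 1)
      have ⟨s, hs, h⟩ := t.2.exists_prev hL.acyclic
      ⟨⟨s, hs⟩, h⟩)
  let h : ∀ i j, (ComplexShape.up ℤ).Rel j i → (K.X i ⟶ L.X j) :=
    fun i j hij => (K.XIsoOfEq (show i = j + 1 from hij.symm)).hom ≫ (σ j).1
  refine ⟨(Homotopy.ofEq ?_).trans (Homotopy.nullHomotopy' h)⟩
  ext n
  obtain ⟨p, rfl⟩ : ∃ p, n = p + 1 := ⟨n - 1, by lia⟩
  rw [Homotopy.nullHomotopicMap'_f (k₂ := p) (k₁ := p + 1) (k₀ := p + 1 + 1) rfl rfl, H p]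
  simp [h, add_comm]

end ChainMaps

section DegreewiseSplit

variable {C : Type u} [Category.{v} C] [Abelian C]

open HomologicalComplex CochainComplex

lemma exists_degreewise_retraction {S : ShortComplex (CochainComplex C ℤ)}
    (σ : ∀ n, (S.map (eval C _ n)).Splitting) :
    ∃ (r : ∀ n, S.X₂.X n ⟶ S.X₁.X n) (s : ∀ n, S.X₃.X n ⟶ S.X₂.X n),
      (∀ n, S.f.f n ≫ r n = 𝟙 _) ∧ (∀ n, s n ≫ S.g.f n = 𝟙 _) ∧
      (∀ n, r n ≫ S.f.f n + S.g.f n ≫ s n = 𝟙 _) :=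
  ⟨fun n => (σ n).r, fun n => (σ n).s, fun n => (σ n).f_r, fun n => (σ n).s_g, fun n => (σ n).id⟩

lemma HomExact.of_degreewiseSplit {S : ShortComplex (CochainComplex C ℤ)}
    (σ : ∀ n, (S.map (eval C _ n)).Splitting) {X : C} (h₁ : HomExact S.X₁ X)
    (h₃ : HomExact S.X₃ X) : HomExact S.X₂ X := by
  obtain ⟨r, s, f_r, s_g, hid⟩ := exists_degreewise_retraction σ
  intro n φ hφ
  obtain ⟨b, hb⟩ := h₁ n (S.f.f n ≫ φ) (by rw [← S.f.comm_assoc, hφ, comp_zero])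
  let φ' : S.X₂.X n ⟶ X := φ - S.X₂.d n (n + 1) ≫ r (n + 1) ≫ b
  have h1 : S.f.f n ≫ φ' = 0 := by
    rw [Preadditive.comp_sub, S.f.comm_assoc, reassoc_of% (f_r (n + 1)), hb, sub_self]
  have h2 : S.g.f n ≫ s n ≫ φ' = φ' := by
    have := hid n =≫ φ'
    rw [Preadditive.add_comp, Category.assoc, h1, comp_zero, zero_add] at this
    simpa using this
  obtain ⟨m, hm⟩ := h₃ n (s n ≫ φ') (by
    have : Epi (S.g.f (n - 1)) := epi_of_epi_fac (s_g (n - 1))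
    rw [← cancel_epi (S.g.f (n - 1)), S.g.comm_assoc, h2]
    simp [φ', hφ])
  refine ⟨r (n + 1) ≫ b + S.g.f (n + 1) ≫ m, ?_⟩
  rw [Preadditive.comp_add, ← S.g.comm_assoc, hm, h2]
  simp [φ']

lemma Acyclic.of_degreewiseSplit {S : ShortComplex (CochainComplex C ℤ)}
    (σ : ∀ n, (S.map (eval C _ n)).Splitting) (h₁ : S.X₁.Acyclic) (h₃ : S.X₃.Acyclic) :
    S.X₂.Acyclic := by
  simp only [← HomotopyCategory.quotient_obj_mem_subcategoryAcyclic_iff_acyclic] at h₁ h₃ ⊢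
  exact (HomotopyCategory.subcategoryAcyclic C).ext_of_isTriangulatedClosed₂ _
    ((HomotopyCategory.distinguished_iff_iso_trianglehOfDegreewiseSplit _).2
      ⟨S, σ, ⟨Iso.refl _⟩⟩) h₁ h₃

lemma IsCompleteProjectiveResolution.of_degreewiseSplit {S : ShortComplex (CochainComplex C ℤ)}
    (σ : ∀ n, (S.map (eval C _ n)).Splitting) (h₁ : IsCompleteProjectiveResolution S.X₁)
    (h₃ : IsCompleteProjectiveResolution S.X₃) : IsCompleteProjectiveResolution S.X₂ where
  projective n := by
    have := h₁.projective n
    have := h₃.projective n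
    obtain ⟨r, s, -, -, hid⟩ := exists_degreewise_retraction σ
    exact Retract.projective (Y := S.X₁.X n ⊞ S.X₃.X n)
      { i := biprod.lift (r n) (S.g.f n)
        r := biprod.desc (S.f.f n) (s n)
        retract := (biprod.lift_desc ..).trans (hid n) }
  acyclic := Acyclic.of_degreewiseSplit σ h₁.acyclic h₃.acyclic
  homExact P hP := HomExact.of_degreewiseSplit σ (h₁.homExact P hP) (h₃.homExact P hP)

lemma IsCompleteProjectiveResolution.mappingCone {K L : CochainComplex C ℤ} (φ : K ⟶ L)
    (hK : IsCompleteProjectiveResolution K) (hL : IsCompleteProjectiveResolution L) :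
    IsCompleteProjectiveResolution (mappingCone φ) :=
  of_degreewiseSplit (S := mappingCone.triangleRotateShortComplex φ)
    (mappingCone.triangleRotateShortComplexSplitting φ) hL (hK.shift 1)

lemma shortExact_cycles_of_degreewiseSplit {S : ShortComplex (CochainComplex C ℤ)}
    (σ : ∀ n, (S.map (eval C _ n)).Splitting) (h₃ : S.X₃.Acyclic) (n : ℤ) :
    (S.map (cyclesFunctor C _ n)).ShortExact := by
  obtain ⟨m, rfl⟩ : ∃ m, n = m + 1 := ⟨n - 1, by lia⟩
  have hS : S.ShortExact := shortExact_of_degreewise_shortExact _ fun n => (σ n).shortExact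
  have := hS.mono_f
  have : Epi (cyclesMap S.g (m + 1)) := by
    obtain ⟨r, s, -, s_g, -⟩ := exists_degreewise_retraction σ
    have := epi_toCycles h₃ m (m + 1) rfl
    have hs : (s m ≫ S.X₂.toCycles m (m + 1)) ≫ cyclesMap S.g (m + 1) =
        S.X₃.toCycles m (m + 1) := by
      rw [← cancel_mono (S.X₃.iCycles (m + 1)), Category.assoc, Category.assoc, cyclesMap_i,
        toCycles_i, toCycles_i_assoc, ← S.g.comm, reassoc_of% (s_g m)]
    exact epi_of_epi_fac hs
  exact
    { exact := cycles_left_exact S hS.exact (m + 1)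
      mono_f := inferInstanceAs (Mono (cyclesMap S.f (m + 1)))
      epi_g := inferInstanceAs (Epi (cyclesMap S.g (m + 1))) }

lemma exists_hom_cycles_mappingCone {K L : CochainComplex C ℤ} (φ : K ⟶ L) {i j : ℤ}
    (hij : 1 + i = j) {X : C} (a : X ⟶ K.cycles j) (g : X ⟶ L.X i)
    (h : a ≫ cyclesMap φ j = g ≫ L.toCycles i j) :
    ∃ θ : X ⟶ (CochainComplex.mappingCone φ).cycles i,
      θ ≫ (CochainComplex.mappingCone φ).iCycles i = g ≫ (mappingCone.inr φ).f i -
        a ≫ K.iCycles j ≫ (mappingCone.inl φ).v j i (by lia) ∧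
      θ ≫ cyclesMap (mappingCone.triangle φ).mor₃ i = a ≫ (cyclesShiftIso K 1 i j hij).inv := by
  have h' : a ≫ K.iCycles j ≫ φ.f j = g ≫ L.d i j := by
    rw [← cyclesMap_i, reassoc_of% h, toCycles_i]
  let p : CochainComplex.mappingCone φ ⟶ K⟦(1 : ℤ)⟧ := (mappingCone.triangle φ).mor₃
  have hp : (mappingCone.inl φ).v j i (by lia) ≫ p.f i =
      -(K.shiftFunctorObjXIso 1 i j (by lia)).inv :=
    mappingCone.inl_v_triangle_mor₃_f φ j i (by lia)
  have hp' : (mappingCone.inr φ).f i ≫ p.f i = 0 := mappingCone.inr_f_triangle_mor₃_f φ i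
  have hθ : (g ≫ (mappingCone.inr φ).f i - a ≫ K.iCycles j ≫ (mappingCone.inl φ).v j i (by lia)) ≫
      (CochainComplex.mappingCone φ).d i j = 0 := by
    rw [Preadditive.sub_comp, Category.assoc, Category.assoc, Category.assoc, mappingCone.inr_f_d,
      mappingCone.inl_v_d φ j i (j + 1) (by lia) (by lia), Preadditive.comp_sub,
      Preadditive.comp_sub, iCycles_d_assoc, zero_comp, comp_zero, sub_zero, reassoc_of% h',
      sub_self]
  refine ⟨liftCycles _ _ j (by simp; lia) hθ, liftCycles_i _ _ _ _ _, ?_⟩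
  change liftCycles _ _ j _ hθ ≫ cyclesMap p i = _
  rw [← cancel_mono (iCycles _ i), Category.assoc, cyclesMap_i, liftCycles_i_assoc,
    Preadditive.sub_comp, Category.assoc, Category.assoc, Category.assoc, hp, hp', comp_zero,
    zero_sub, Preadditive.comp_neg, Preadditive.comp_neg, neg_neg, ← cancel_mono
    (K.shiftFunctorObjXIso 1 i j (by lia)).hom, Category.assoc, Category.assoc, Category.assoc,
    Category.assoc, Iso.inv_hom_id, Category.comp_id]
  rw [← cyclesShiftIso_hom_iCycles K 1 i j hij, Iso.inv_hom_id_assoc]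

/-- The horseshoe lemma for complete projective resolutions. -/
lemma exists_degreewiseSplit_iso_cycles {S : ShortComplex C} (hS : S.ShortExact)
    (h₁ : GP C S.X₁) (h₃ : GP C S.X₃) :
    ∃ (T : ShortComplex (CochainComplex C ℤ)) (_ : ∀ n, (T.map (eval C _ n)).Splitting),
      IsCompleteProjectiveResolution T.X₁ ∧ IsCompleteProjectiveResolution T.X₃ ∧
        Nonempty (S ≅ T.map (cyclesFunctor C _ 0)) := by
  obtain ⟨L, hL, ⟨e₁⟩⟩ := (GP_iff_exists_iso_cycles _ 0).1 h₁
  obtain ⟨K, hK, ⟨e₃⟩⟩ := (GP_iff_exists_iso_cycles _ 1).1 h₃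
  have := hL.projective 0
  have := hS.epi_g
  obtain ⟨g, hg⟩ := GP.exists_extension hS h₃ (e₁.hom ≫ L.iCycles 0)
  obtain ⟨w, hw⟩ : ∃ w : S.X₃ ⟶ L.cycles 1, S.g ≫ w = g ≫ L.toCycles 0 1 :=
    have h : S.f ≫ g ≫ L.toCycles 0 1 = 0 := by rw [reassoc_of% hg, iCycles_toCycles, comp_zero]
    ⟨hS.exact.desc _ h, hS.exact.g_desc _ h⟩
  obtain ⟨φ, hφ⟩ := hK.exists_hom hL 1 (e₃.inv ≫ w)
  obtain ⟨θ, hθ, hθ'⟩ := exists_hom_cycles_mappingCone φ (add_zero 1) (S.g ≫ e₃.hom) g (by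
    rw [hφ, Category.assoc, e₃.hom_inv_id_assoc, hw])
  let T := mappingCone.triangleRotateShortComplex φ
  let Φ : S ⟶ T.map (cyclesFunctor C _ 0) :=
    { τ₁ := e₁.hom
      τ₂ := θ
      τ₃ := e₃.hom ≫ (cyclesShiftIso K 1 0 1 rfl).inv
      comm₁₂ := by
        change e₁.hom ≫ cyclesMap (mappingCone.inr φ) 0 = S.f ≫ θ
        rw [← cancel_mono (iCycles _ 0), Category.assoc, Category.assoc, hθ, cyclesMap_i,
          Preadditive.comp_sub, Category.assoc, S.zero_assoc, zero_comp, sub_zero, reassoc_of% hg]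
      comm₂₃ := hθ'.trans (Category.assoc _ _ _) }
  have : IsIso Φ.τ₁ := inferInstanceAs (IsIso e₁.hom)
  have : IsIso Φ.τ₃ := inferInstanceAs (IsIso (e₃.hom ≫ (cyclesShiftIso K 1 0 1 rfl).inv))
  have hσ := mappingCone.triangleRotateShortComplexSplitting φ
  have := ShortComplex.isIso₂_of_shortExact_of_isIso₁₃ Φ hS
    (shortExact_cycles_of_degreewiseSplit hσ (hK.shift 1).acyclic 0)
  have := ShortComplex.isIso_of_isIso Φ
  exact ⟨T, hσ, hL, hK.shift 1, ⟨asIso Φ⟩⟩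

lemma GP.of_shortExact {S : ShortComplex C} (hS : S.ShortExact) (h₁ : GP C S.X₁)
    (h₃ : GP C S.X₃) : GP C S.X₂ := by
  obtain ⟨T, σ, hT₁, hT₃, ⟨e⟩⟩ := exists_degreewiseSplit_iso_cycles hS h₁ h₃
  exact (GP C).prop_of_iso (ShortComplex.π₂.mapIso e).symm
    ((IsCompleteProjectiveResolution.of_degreewiseSplit σ hT₁ hT₃).GP_cycles 0)

lemma GP.biprod {X Y : C} (hX : GP C X) (hY : GP C Y) : GP C (X ⊞ Y) :=
  GP.of_shortExact (S := ShortComplex.mk biprod.inl biprod.snd (by simp))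
    (ShortComplex.Splitting.ofHasBinaryBiproduct X Y).shortExact hX hY

lemma shortComplex_mk_cokernel_shortExact {X Y : C} (f : X ⟶ Y) [Mono f] :
    (ShortComplex.mk f (cokernel.π f) (cokernel.condition f)).ShortExact where
  exact := ShortComplex.exact_cokernel f

end DegreewiseSplit

section Tac

variable {C : Type u} [Category.{v} C] [Abelian C]

lemma isCompleteProjectiveResolution_of_homotopy {K : CochainComplex C ℤ}
    (hK : ∀ n, Projective (K.X n)) (H : Homotopy (𝟙 K) 0) : IsCompleteProjectiveResolution K where
  projective := hK
  acyclic n := (K.exactAt_iff_isZero_homology n).2 ((IsZero.iff_id_eq_zero _).2 (by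
    rw [← HomologicalComplex.homologyMap_id, H.homologyMap_eq,
      HomologicalComplex.homologyMap_zero]))
  homExact P _ n f hf := by
    have hn := H.comm n
    rw [dNext_eq _ (show (ComplexShape.up ℤ).Rel n (n + 1) from rfl),
      prevD_eq _ (show (ComplexShape.up ℤ).Rel (n - 1) n from sub_add_cancel n 1),
      HomologicalComplex.id_f, HomologicalComplex.zero_f, add_zero] at hn
    refine ⟨H.hom (n + 1) n ≫ f, ?_⟩
    rw [← Category.assoc, eq_sub_of_add_eq hn.symm, Preadditive.sub_comp, Category.id_comp,
      Category.assoc, hf, comp_zero, sub_zero]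

variable (C) in
/-- Complete projective resolutions, as a property of objects of the homotopy category. -/
def tac : ObjectProperty (HomotopyCategory C (ComplexShape.up ℤ)) :=
  fun K => IsCompleteProjectiveResolution K.as

instance : (tac C).ContainsZero where
  exists_zero := ⟨(HomotopyCategory.quotient _ _).obj 0, Functor.map_isZero _ (isZero_zero _),
    isCompleteProjectiveResolution_of_homotopy
      (fun n => ((HomologicalComplex.eval C _ n).map_isZero (isZero_zero _)).projective)
      (.ofEq ((isZero_zero _).eq_of_src _ _))⟩

instance : (tac C).IsStableUnderShift ℤ where
  isStableUnderShiftBy n :=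
    { le_shift K hK := by
        obtain ⟨K : CochainComplex _ _, rfl⟩ := K.quotient_obj_surjective
        rw [ObjectProperty.prop_shift_iff, HomotopyCategory.shift_quotient_obj]
        exact IsCompleteProjectiveResolution.shift hK n }

instance : (tac C).IsTriangulatedClosed₃ where
  ext₃' T hT h₁ h₂ := by
    let φ : T.obj₁.as ⟶ T.obj₂.as := (HomotopyCategory.quotient C _).preimage T.mor₁
    have hφ : (HomotopyCategory.quotient C _).map φ = T.mor₁ := Functor.map_preimage _ _
    exact ⟨_, IsCompleteProjectiveResolution.mappingCone φ h₁ h₂,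
      ⟨Triangle.π₃.mapIso (isoTriangleOfIso₁₂ T _ hT
        (HomotopyCategory.mappingCone_triangleh_distinguished φ) (Iso.refl _) (Iso.refl _)
        ((Category.comp_id _).trans (hφ.symm.trans (Category.id_comp _).symm)))⟩⟩

instance : (tac C).IsTriangulated where
  toIsTriangulatedClosed₂ := .of_isTriangulatedClosed₃

variable (C) in
/-- The homotopy category of complete projective resolutions. -/
abbrev Tac := (tac C).FullSubcategory

variable (C) in
/-- The category of complete projective resolutions and chain maps. -/
abbrev CompleteResolution :=
  ObjectProperty.FullSubcategory (C := CochainComplex C ℤ) IsCompleteProjectiveResolution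

variable (C) in
/-- The inclusion of complete projective resolutions in cochain complexes. -/
abbrev resolutionι : CompleteResolution C ⥤ CochainComplex C ℤ :=
  ObjectProperty.ι (C := CochainComplex C ℤ) IsCompleteProjectiveResolution

instance : ObjectProperty.IsStableUnderShift (C := CochainComplex C ℤ)
    IsCompleteProjectiveResolution ℤ where
  isStableUnderShiftBy n := { le_shift _ hK := hK.shift n }

variable (C) in
/-- The functor from chain maps to homotopy classes. -/
def toTac : CompleteResolution C ⥤ Tac C :=
  (tac C).lift (resolutionι C ⋙ HomotopyCategory.quotient C (ComplexShape.up ℤ))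
    fun K => K.property

variable (C) in
/-- `toTac` is the corestriction of the quotient functor to the homotopy category. -/
def toTacCompι : toTac C ⋙ (tac C).ι ≅
    resolutionι C ⋙ HomotopyCategory.quotient C (ComplexShape.up ℤ) :=
  (tac C).liftCompιIso _ _

instance : (toTac C).CommShift ℤ := .ofComp (toTacCompι C) ℤ

instance : NatTrans.CommShift (toTacCompι C).hom ℤ :=
  Functor.CommShift.ofComp_compatibility _ _

instance : (toTac C).Full where
  map_surjective f :=
    have ⟨g, hg⟩ := (HomotopyCategory.quotient C (ComplexShape.up ℤ)).map_surjective f.hom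
    ⟨ObjectProperty.homMk g, ObjectProperty.hom_ext _ hg⟩

instance : (toTac C).Additive where
  map_add := ObjectProperty.hom_ext _ ((HomotopyCategory.quotient C _).map_add)

lemma toTac_map_eq_iff {K L : CompleteResolution C} (f g : K ⟶ L) :
    (toTac C).map f = (toTac C).map g ↔ Nonempty (Homotopy f.hom g.hom) :=
  ⟨fun h => ⟨HomotopyCategory.homotopyOfEq _ _ (congrArg (·.hom) h)⟩,
    fun ⟨H⟩ => ObjectProperty.hom_ext _ (HomotopyCategory.eq_of_homotopy _ _ H)⟩

/-- A complete projective resolution underlying an object of the homotopy category. -/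
abbrev Tac.resolution (K : Tac C) : CompleteResolution C := ⟨K.obj.as, K.property⟩

end Tac

section Cycles

variable {C : Type u} [Category.{v} C] [Abelian C]

open HomologicalComplex

lemma toStable_map_eq_iff {X Y : (GP C).FullSubcategory} (f g : X ⟶ Y) :
    (toStable C).map f = (toStable C).map g ↔ stableRel C f g :=
  Quotient.functor_map_eq_iff (stableRel C) f g

lemma toStable_map_eq_of_factor {X Y : (GP C).FullSubcategory} (f g : X ⟶ Y) {P : C}
    [hP : Projective P] (a : X.obj ⟶ P) (b : P ⟶ Y.obj) (h : f.hom - g.hom = a ≫ b) :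
    (toStable C).map f = (toStable C).map g :=
  (toStable_map_eq_iff f g).2 ⟨P, hP, a, b, h⟩

/-- The inclusion of a direct summand with projective complement is a stable isomorphism. -/
def toStableIso {X Y : (GP C).FullSubcategory} (s : X ⟶ Y) (r : Y ⟶ X) (hs : s ≫ r = 𝟙 X) {P : C}
    [Projective P] (a : Y.obj ⟶ P) (b : P ⟶ Y.obj) (h : r.hom ≫ s.hom + a ≫ b = 𝟙 Y.obj) :
    (toStable C).obj X ≅ (toStable C).obj Y where
  hom := (toStable C).map s
  inv := (toStable C).map r
  hom_inv_id := by rw [← Functor.map_comp, hs, CategoryTheory.Functor.map_id]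
  inv_hom_id := by
    rw [← Functor.map_comp, ← CategoryTheory.Functor.map_id]
    refine toStable_map_eq_of_factor _ _ a (-b) ?_
    rw [Preadditive.comp_neg]
    exact sub_eq_of_eq_add' (eq_add_neg_of_add_eq h)

instance : (toStable C).Full := inferInstanceAs (Quotient.functor (stableRel C)).Full

instance : (toStable C).EssSurj := inferInstanceAs (Quotient.functor (stableRel C)).EssSurj

instance additive_cyclesFunctor (n : ℤ) :
    (cyclesFunctor C (ComplexShape.up ℤ) n).Additive where
  map_add {K L f g} := by
    change cyclesMap (f + g) n = cyclesMap f n + cyclesMap g n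
    rw [← cancel_mono (L.iCycles n)]
    simp

variable (C) in
/-- The cycles of a fixed degree of a complete projective resolution. -/
def cyclesGP (n : ℤ) : CompleteResolution C ⥤ (GP C).FullSubcategory :=
  (GP C).lift (resolutionι C ⋙ cyclesFunctor C (ComplexShape.up ℤ) n)
    fun K => K.property.GP_cycles n

instance (n : ℤ) : (cyclesGP C n).Additive where
  map_add := ObjectProperty.hom_ext _ ((cyclesFunctor C _ n).map_add)

instance : (cyclesGP C 0).Full where
  map_surjective {K L} f :=
    have ⟨g, hg⟩ := K.property.exists_hom L.property 0 f.hom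
    ⟨ObjectProperty.homMk g, ObjectProperty.hom_ext _ hg⟩

instance : (cyclesGP C 0).EssSurj where
  mem_essImage X :=
    have ⟨K, hK, ⟨e⟩⟩ := (GP_iff_exists_iso_cycles _ 0).1 X.property
    ⟨⟨K, hK⟩, ⟨(GP C).isoMk e.symm⟩⟩

lemma nonempty_homotopy_of_cycles_sub_eq_comp {K L : CochainComplex C ℤ}
    (hK : IsCompleteProjectiveResolution K) (hL : IsCompleteProjectiveResolution L) (f g : K ⟶ L)
    {P : C} [hP : Projective P] (a : K.cycles 0 ⟶ P) (b : P ⟶ L.cycles 0)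
    (h : cyclesMap f 0 - cyclesMap g 0 = a ≫ b) : Nonempty (Homotopy f g) := by
  obtain ⟨a', rfl⟩ := (hK.homExact P hP).exists_extension hK.acyclic 0 a
  obtain ⟨b', rfl⟩ := exists_comp_toCycles_eq hL.acyclic (-1) 0 rfl b
  obtain ⟨H⟩ := hK.nonempty_homotopy hL (f := f - g) (m := -1) (s := a' ≫ b') (by
    have h' := h =≫ L.iCycles 0
    rw [Preadditive.sub_comp, cyclesMap_i, cyclesMap_i, ← Preadditive.comp_sub, Category.assoc,
      Category.assoc, Category.assoc, toCycles_i] at h'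
    exact (K.iCycles 0 ≫= Category.assoc _ _ _).trans h'.symm)
  exact ⟨Homotopy.equivSubZero.symm H⟩

lemma cyclesMap_sub_eq_of_homotopy {K L : CochainComplex C ℤ} {f g : K ⟶ L} (H : Homotopy f g)
    {i j : ℤ} (hij : i + 1 = j) :
    cyclesMap f j - cyclesMap g j = K.iCycles j ≫ H.hom j i ≫ L.toCycles i j := by
  have h := K.iCycles j ≫= H.comm j
  rw [dNext_eq _ (show (ComplexShape.up ℤ).Rel j (j + 1) from rfl), prevD_eq _ hij,
    Preadditive.comp_add, Preadditive.comp_add, iCycles_d_assoc, zero_comp, zero_add] at h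
  rw [← cancel_mono (L.iCycles j), Preadditive.sub_comp, cyclesMap_i, cyclesMap_i, h]
  simp

lemma toStable_map_cyclesGP_eq_iff {K L : CompleteResolution C} (f g : K ⟶ L) :
    (toStable C).map ((cyclesGP C 0).map f) = (toStable C).map ((cyclesGP C 0).map g) ↔
      (toTac C).map f = (toTac C).map g := by
  rw [toTac_map_eq_iff]
  constructor
  · intro h
    obtain ⟨P, hP, a, b, hab⟩ := (toStable_map_eq_iff _ _).1 h
    exact nonempty_homotopy_of_cycles_sub_eq_comp K.property L.property f.hom g.hom a b hab
  · rintro ⟨H⟩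
    have := L.property.projective (-1)
    exact toStable_map_eq_of_factor _ _ (K.obj.iCycles 0 ≫ H.hom 0 (-1)) (L.obj.toCycles (-1) 0)
      ((cyclesMap_sub_eq_of_homotopy H (neg_add_cancel 1)).trans (Category.assoc _ _ _).symm)

variable (C) in
/-- The cycles of degree `0` of a complete projective resolution, in the stable category. -/
abbrev resolutionCycles : CompleteResolution C ⥤ StableGP C := cyclesGP C 0 ⋙ toStable C

/-- A chain map representing a homotopy class. -/
def Tac.representative {K L : Tac C} (f : K ⟶ L) : K.resolution ⟶ L.resolution :=
  (toTac C).preimage f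

lemma toTac_map_representative {K L : Tac C} (f : K ⟶ L) :
    (toTac C).map (Tac.representative f) = f :=
  (toTac C).map_preimage (X := K.resolution) (Y := L.resolution) f

lemma resolutionCycles_map_representative {K L : Tac C} (f : K ⟶ L)
    (g : K.resolution ⟶ L.resolution) (h : (toTac C).map g = f) :
    (resolutionCycles C).map (Tac.representative f) = (resolutionCycles C).map g :=
  (toStable_map_cyclesGP_eq_iff _ _).2 ((toTac_map_representative f).trans h.symm)

variable (C) in
/-- The factorization of `resolutionCycles` through the homotopy category. -/
def stableCycles : Tac C ⥤ StableGP C where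
  obj K := (resolutionCycles C).obj K.resolution
  map f := (resolutionCycles C).map (Tac.representative f)
  map_id _ := (resolutionCycles_map_representative _ (𝟙 _) ((toTac C).map_id _)).trans
    ((resolutionCycles C).map_id _)
  map_comp f g := (resolutionCycles_map_representative _ _
    (((toTac C).map_comp _ _).trans (congrArg₂ (fun a b : _ ⟶ _ => a ≫ b)
      (toTac_map_representative f) (toTac_map_representative g)))).trans (Functor.map_comp _ _ _)

variable (C) in
/-- `stableCycles` extends `resolutionCycles`. -/
def toTacCompStableCycles : toTac C ⋙ stableCycles C ≅ resolutionCycles C :=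
  NatIso.ofComponents (fun _ => Iso.refl _) fun f => (Category.comp_id _).trans
    ((resolutionCycles_map_representative _ f rfl).trans (Category.id_comp _).symm)

instance : (stableCycles C).Full where
  map_surjective {K L} f :=
    have ⟨g, hg⟩ := (resolutionCycles C).map_surjective (X := K.resolution) (Y := L.resolution) f
    ⟨(toTac C).map g, (resolutionCycles_map_representative _ g rfl).trans hg⟩

instance : (stableCycles C).Faithful where
  map_injective {_ _} f g h := (toTac_map_representative f).symm.trans
    (((toStable_map_cyclesGP_eq_iff _ _).1 h).trans (toTac_map_representative g))

instance : (stableCycles C).EssSurj where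
  mem_essImage X := ⟨(toTac C).obj ((resolutionCycles C).objPreimage X),
    ⟨(resolutionCycles C).objObjPreimageIso X⟩⟩

instance : (stableCycles C).IsEquivalence where

instance : (stableCycles C).Additive where
  map_add {K L f g} := (resolutionCycles_map_representative _
    (Tac.representative f + Tac.representative g) ((Functor.map_add _).trans
      (congrArg₂ (fun a b : K ⟶ L => a + b) (toTac_map_representative f)
        (toTac_map_representative g)))).trans (Functor.map_add _)

end Cycles

section Transport

open MorphismProperty

instance isomorphisms_hasLeftCalculusOfFractions (T : Type*) [Category* T] :
    (isomorphisms T).HasLeftCalculusOfFractions where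
  exists_leftFraction X Y φ :=
    have : IsIso φ.s := φ.hs
    ⟨⟨inv φ.s ≫ φ.f, 𝟙 _, isomorphisms.infer_property _⟩, by simp⟩
  ext X' X Y f₁ f₂ s hs h :=
    have : IsIso s := hs
    ⟨Y, 𝟙 _, isomorphisms.infer_property _, by rw [(cancel_epi s).1 h]⟩

instance isomorphisms_isCompatibleWithShift (T : Type*) [Category* T] [HasShift T ℤ] :
    (isomorphisms T).IsCompatibleWithShift ℤ where
  condition n := by
    ext X Y f
    exact isIso_iff_of_reflects_iso f (shiftFunctor T n)

instance isomorphisms_isCompatibleWithTriangulation (T : Type*) [Category* T] [HasShift T ℤ]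
    [Preadditive T] [HasZeroObject T] [∀ n : ℤ, (shiftFunctor T n).Additive]
    [Pretriangulated T] : (isomorphisms T).IsCompatibleWithTriangulation where
  compatible_with_triangulation T₁ T₂ h₁ h₂ a b ha hb comm := by
    obtain ⟨c, hc₁, hc₂⟩ := complete_distinguished_triangle_morphism T₁ T₂ h₁ h₂ a b comm
    exact ⟨c, isIso₃_of_isIso₁₂ (Triangle.homMk T₁ T₂ a b c comm hc₁ hc₂) h₁ h₂ ha hb, hc₁, hc₂⟩

instance isLocalization_isomorphisms {T D : Type*} [Category* T] [Category* D] (L : T ⥤ D)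
    [L.IsEquivalence] : L.IsLocalization (isomorphisms T) :=
  Functor.IsLocalization.of_isEquivalence _ _ (fun _ _ _ h => h)

end Transport

namespace StableShift

open MorphismProperty

variable (C : Type u) [Category.{v} C] [Abelian C]

scoped instance hasShift : HasShift (StableGP C) ℤ :=
  HasShift.localized (stableCycles C) (isomorphisms (Tac C)) ℤ

scoped instance stableCyclesCommShift : (stableCycles C).CommShift ℤ :=
  Functor.CommShift.localized (stableCycles C) (isomorphisms (Tac C)) ℤ

scoped instance shift_additive (n : ℤ) : (shiftFunctor (StableGP C) n).Additive := by
  rw [Localization.functor_additive_iff (stableCycles C) (isomorphisms (Tac C))]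
  exact Functor.additive_of_iso ((stableCycles C).commShiftIso n)

scoped instance pretriangulated : Pretriangulated (StableGP C) :=
  Triangulated.Localization.pretriangulated (stableCycles C) (isomorphisms (Tac C))

scoped instance stableCycles_isTriangulated : (stableCycles C).IsTriangulated :=
  Triangulated.Localization.isTriangulated_functor (stableCycles C) (isomorphisms (Tac C))

scoped instance isTriangulated : IsTriangulated (StableGP C) :=
  Triangulated.Localization.isTriangulated (stableCycles C) (isomorphisms (Tac C))

end StableShift

section ShiftCycles

open scoped StableShift

variable (C : Type u) [Category.{v} C] [Abelian C]

instance : (resolutionCycles C).CommShift ℤ := .ofIso (toTacCompStableCycles C) ℤ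

instance : NatTrans.CommShift (toTacCompStableCycles C).hom ℤ :=
  Functor.CommShift.ofIso_compatibility _ _

/-- The cycles of degree `0` of a shifted complex are its cycles of degree `1`. -/
def shiftCompCyclesFunctor : shiftFunctor (CochainComplex C ℤ) (1 : ℤ) ⋙
    HomologicalComplex.cyclesFunctor C (ComplexShape.up ℤ) 0 ≅
      HomologicalComplex.cyclesFunctor C (ComplexShape.up ℤ) 1 :=
  NatIso.ofComponents (fun K => cyclesShiftIso K 1 0 1 (add_zero 1))
    fun f => cyclesShiftIso_hom_naturality f 1 0 1 (add_zero 1)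

/-- The restriction of `shiftCompCyclesFunctor` to complete projective resolutions. -/
def shiftCompCyclesGP :
    shiftFunctor (CompleteResolution C) (1 : ℤ) ⋙ cyclesGP C 0 ≅ cyclesGP C 1 :=
  let e : (shiftFunctor _ (1 : ℤ) ⋙ resolutionι C) ⋙ HomologicalComplex.cyclesFunctor C _ 0 ≅
      resolutionι C ⋙ HomologicalComplex.cyclesFunctor C _ 1 :=
    Functor.isoWhiskerRight ((resolutionι C).commShiftIso (1 : ℤ)) _ ≪≫
      Functor.isoWhiskerLeft (resolutionι C) (shiftCompCyclesFunctor C)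
  Functor.fullyFaithfulCancelRight (GP C).ι e

/-- In the stable category, the cycles of degree `1` are the shift of the cycles of degree `0`. -/
def shiftCyclesIso :
    resolutionCycles C ⋙ shiftFunctor (StableGP C) (1 : ℤ) ≅ cyclesGP C 1 ⋙ toStable C :=
  ((resolutionCycles C).commShiftIso (1 : ℤ)).symm ≪≫
    Functor.isoWhiskerRight (shiftCompCyclesGP C) (toStable C)

end ShiftCycles

section Connecting

open scoped StableShift

variable {C : Type u} [Category.{v} C] [Abelian C]

open HomologicalComplex

/-- Two extensions to `S.X₂` of a morphism on `S.X₁` differ by a morphism on `S.X₃`. -/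
lemma exists_comp_sub_comp_cyclesMap_eq {S S' : ShortComplex C} (hS : S.ShortExact) (φ : S ⟶ S')
    {K L : CochainComplex C ℤ} (f : K ⟶ L) {a : S.X₁ ⟶ K.cycles 0} {a' : S'.X₁ ⟶ L.cycles 0}
    {b : S.X₂ ⟶ K.X 0} {b' : S'.X₂ ⟶ L.X 0} {c : S.X₃ ⟶ K.cycles 1} {c' : S'.X₃ ⟶ L.cycles 1}
    (h₁ : S.f ≫ b = a ≫ K.iCycles 0) (h₁' : S'.f ≫ b' = a' ≫ L.iCycles 0)
    (h₂ : S.g ≫ c = b ≫ K.toCycles 0 1) (h₂' : S'.g ≫ c' = b' ≫ L.toCycles 0 1)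
    (hf : a ≫ cyclesMap f 0 = φ.τ₁ ≫ a') :
    ∃ w : S.X₃ ⟶ L.X 0, φ.τ₃ ≫ c' - c ≫ cyclesMap f 1 = w ≫ L.toCycles 0 1 := by
  have h₃ : S.f ≫ (φ.τ₂ ≫ b' - b ≫ f.f 0) = 0 := by
    rw [Preadditive.comp_sub, ← φ.comm₁₂_assoc, h₁', reassoc_of% h₁, ← cyclesMap_i,
      reassoc_of% hf, sub_self]
  have := hS.epi_g
  refine ⟨hS.exact.desc _ h₃, ?_⟩
  have hfc : K.toCycles 0 1 ≫ cyclesMap f 1 = f.f 0 ≫ L.toCycles 0 1 := by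
    rw [← cancel_mono (L.iCycles 1)]
    simp
  rw [← cancel_epi S.g, hS.exact.g_desc_assoc, Preadditive.comp_sub, Preadditive.sub_comp,
    Category.assoc, Category.assoc, ← h₂', ← hfc, ← reassoc_of% h₂, φ.comm₂₃_assoc]

/-- The data computing the connecting morphism of a short exact sequence: a complete projective
resolution whose cycles of degree `0` are the first object, and a morphism from the sequence
to `Z⁰K ⟶ K⁰ ⟶ Z¹K`. -/
structure ConnectingData (S : ShortComplex (GP C).FullSubcategory) where
  /-- a complete projective resolution -/
  K : CompleteResolution C
  /-- the identification of its cycles with the first object -/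
  e : S.X₁ ≅ (cyclesGP C 0).obj K
  /-- the morphism on the second object -/
  g : S.X₂.obj ⟶ K.obj.X 0
  /-- the morphism on the third object -/
  h : S.X₃ ⟶ (cyclesGP C 1).obj K
  comm₁ : S.f.hom ≫ g = e.hom.hom ≫ K.obj.iCycles 0
  comm₂ : S.g.hom ≫ h.hom = g ≫ K.obj.toCycles 0 1

namespace ConnectingData

variable {S S' : ShortComplex (GP C).FullSubcategory}

/-- The connecting morphism. The sign makes the triangle of a degreewise split sequence of
complexes agree with that of the homotopy category. -/
def δ (D : ConnectingData S) : (toStable C).obj S.X₃ ⟶ ((toStable C).obj S.X₁)⟦(1 : ℤ)⟧ :=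
  -((toStable C).map D.h ≫ (shiftCyclesIso C).inv.app D.K ≫ ((toStable C).map D.e.inv)⟦(1 : ℤ)⟧')

lemma toStable_map_comp_h (hS : (S.map (GP C).ι).ShortExact) (D : ConnectingData S)
    (D' : ConnectingData S') (φ : S ⟶ S') (f : D.K ⟶ D'.K)
    (hf : D.e.hom ≫ (cyclesGP C 0).map f = φ.τ₁ ≫ D'.e.hom) :
    (toStable C).map (φ.τ₃ ≫ D'.h) = (toStable C).map (D.h ≫ (cyclesGP C 1).map f) := by
  obtain ⟨w, hw⟩ := exists_comp_sub_comp_cyclesMap_eq hS ((GP C).ι.mapShortComplex.map φ) f.hom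
    D.comm₁ D'.comm₁ D.comm₂ D'.comm₂ (congrArg (·.hom) hf)
  have := D'.K.property.projective 0
  exact toStable_map_eq_of_factor _ _ w (D'.K.obj.toCycles 0 1) hw

lemma δ_naturality (hS : (S.map (GP C).ι).ShortExact) (D : ConnectingData S)
    (D' : ConnectingData S') (φ : S ⟶ S') :
    (toStable C).map φ.τ₃ ≫ D'.δ = D.δ ≫ ((toStable C).map φ.τ₁)⟦(1 : ℤ)⟧' := by
  obtain ⟨f, hf⟩ := (cyclesGP C 0).map_surjective (D.e.inv ≫ φ.τ₁ ≫ D'.e.hom)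
  have hh := toStable_map_comp_h hS D D' φ f (by rw [hf, Iso.hom_inv_id_assoc])
  have hσ : (shiftCyclesIso C).inv.app D.K ≫ ((toStable C).map ((cyclesGP C 0).map f))⟦(1 : ℤ)⟧' =
      (toStable C).map ((cyclesGP C 1).map f) ≫ (shiftCyclesIso C).inv.app D'.K :=
    ((shiftCyclesIso C).inv.naturality f).symm
  have he : ((toStable C).map ((cyclesGP C 0).map f))⟦(1 : ℤ)⟧' ≫
      ((toStable C).map D'.e.inv)⟦(1 : ℤ)⟧' =
      ((toStable C).map D.e.inv)⟦(1 : ℤ)⟧' ≫ ((toStable C).map φ.τ₁)⟦(1 : ℤ)⟧' := by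
    rw [← Functor.map_comp, ← Functor.map_comp, ← Functor.map_comp, ← Functor.map_comp, hf]
    simp
  rw [δ, δ, Preadditive.comp_neg, Preadditive.neg_comp, ← Functor.map_comp_assoc, hh,
    Functor.map_comp_assoc, ← reassoc_of% hσ, he, Category.assoc, Category.assoc]

lemma nonempty (hS : (S.map (GP C).ι).ShortExact) : Nonempty (ConnectingData S) := by
  obtain ⟨K, hK, ⟨e⟩⟩ := (GP_iff_exists_iso_cycles _ 0).1 S.X₁.property
  have := hK.projective 0
  obtain ⟨g, hg⟩ : ∃ g : S.X₂.obj ⟶ K.X 0, S.f.hom ≫ g = e.hom ≫ K.iCycles 0 :=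
    GP.exists_extension hS S.X₃.property (e.hom ≫ K.iCycles 0)
  have : Epi (S.map (GP C).ι).g := hS.epi_g
  have h0 : S.f.hom ≫ g ≫ K.toCycles 0 1 = 0 := by
    rw [reassoc_of% hg, iCycles_toCycles, comp_zero]
  exact ⟨⟨⟨K, hK⟩, (GP C).isoMk e, g, ObjectProperty.homMk (hS.exact.desc _ h0), hg,
    hS.exact.g_desc _ h0⟩⟩

end ConnectingData

/-- The connecting morphism of a short exact sequence of Gorenstein projective objects. -/
def connectingHom (S : ShortComplex (GP C).FullSubcategory) (hS : (S.map (GP C).ι).ShortExact) :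
    (toStable C).obj S.X₃ ⟶ ((toStable C).obj S.X₁)⟦(1 : ℤ)⟧ :=
  (ConnectingData.nonempty hS).some.δ

lemma connectingHom_naturality {S S' : ShortComplex (GP C).FullSubcategory}
    (hS : (S.map (GP C).ι).ShortExact) (hS' : (S'.map (GP C).ι).ShortExact) (φ : S ⟶ S') :
    (toStable C).map φ.τ₃ ≫ connectingHom S' hS' =
      connectingHom S hS ≫ ((toStable C).map φ.τ₁)⟦(1 : ℤ)⟧' :=
  ConnectingData.δ_naturality hS _ _ φ

lemma connectingHom_eq {S : ShortComplex (GP C).FullSubcategory}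
    (hS : (S.map (GP C).ι).ShortExact) (D : ConnectingData S) : connectingHom S hS = D.δ := by
  have := ConnectingData.δ_naturality hS (ConnectingData.nonempty hS).some D (𝟙 S)
  simpa [connectingHom] using this.symm

/-- The triangle of a short exact sequence of Gorenstein projective objects. -/
abbrev stableTriangle (S : ShortComplex (GP C).FullSubcategory)
    (hS : (S.map (GP C).ι).ShortExact) : Triangle (StableGP C) :=
  Triangle.mk ((toStable C).map S.f) ((toStable C).map S.g) (connectingHom S hS)

/-- The triangles of isomorphic short exact sequences are isomorphic. -/
def stableTriangleIso {S S' : ShortComplex (GP C).FullSubcategory}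
    (hS : (S.map (GP C).ι).ShortExact) (hS' : (S'.map (GP C).ι).ShortExact) (e : S ≅ S') :
    stableTriangle S hS ≅ stableTriangle S' hS' :=
  Triangle.isoMk _ _ ((toStable C).mapIso (ShortComplex.π₁.mapIso e))
    ((toStable C).mapIso (ShortComplex.π₂.mapIso e))
    ((toStable C).mapIso (ShortComplex.π₃.mapIso e))
    (((toStable C).map_comp _ _).symm.trans
      ((congrArg (toStable C).map e.hom.comm₁₂.symm).trans ((toStable C).map_comp _ _)))
    (((toStable C).map_comp _ _).symm.trans
      ((congrArg (toStable C).map e.hom.comm₂₃.symm).trans ((toStable C).map_comp _ _)))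
    (connectingHom_naturality hS hS' e.hom).symm

end Connecting

section Triangulation

open scoped StableShift

variable {C : Type u} [Category.{v} C] [Abelian C]

open HomologicalComplex CochainComplex

variable (T : ShortComplex (CompleteResolution C))
  (σ : ∀ n, ((T.map (resolutionι C)).map (eval C _ n)).Splitting)

/-- The connecting morphism of a degreewise split sequence of complete projective resolutions. -/
def splitHom : T.X₃ ⟶ T.X₁⟦(1 : ℤ)⟧ :=
  ObjectProperty.homMk (homOfDegreewiseSplit (T.map (resolutionι C)) σ ≫
    ((resolutionι C).commShiftIso (1 : ℤ)).inv.app T.X₁)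

lemma splitHom_hom_comp_commShiftIso_hom :
    (splitHom T σ).hom ≫ ((resolutionι C).commShiftIso (1 : ℤ)).hom.app T.X₁ =
      homOfDegreewiseSplit (T.map (resolutionι C)) σ :=
  (Category.assoc _ _ _).trans (((homOfDegreewiseSplit (T.map (resolutionι C)) σ) ≫=
    ((resolutionι C).commShiftIso (1 : ℤ)).inv_hom_id_app T.X₁).trans (Category.comp_id _))

/-- The triangle of a degreewise split sequence of complete projective resolutions. -/
abbrev splitTriangle : Triangle (CompleteResolution C) := Triangle.mk T.f T.g (splitHom T σ)

/-- `splitTriangle` is the usual triangle of a degreewise split sequence of complexes. -/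
def mapSplitTriangleIso : (resolutionι C).mapTriangle.obj (splitTriangle T σ) ≅
    triangleOfDegreewiseSplit (T.map (resolutionι C)) σ :=
  Triangle.isoMk _ _ (Iso.refl _) (Iso.refl _) (Iso.refl _)
    ((Category.comp_id _).trans (Category.id_comp _).symm)
    ((Category.comp_id _).trans (Category.id_comp _).symm)
    ((congrArg (_ ≫ ·) (CategoryTheory.Functor.map_id _ _)).trans ((Category.comp_id _).trans
      ((splitHom_hom_comp_commShiftIso_hom T σ).trans (Category.id_comp _).symm)))

lemma toTac_map_splitTriangle_distinguished :
    (toTac C).mapTriangle.obj (splitTriangle T σ) ∈ distTriang (Tac C) := by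
  rw [← (tac C).ι.map_distinguished_iff]
  exact (HomotopyCategory.distinguished_iff_iso_trianglehOfDegreewiseSplit _).2 ⟨_, σ,
    ⟨(Functor.mapTriangleCompIso (toTac C) (tac C).ι).symm.app _ ≪≫
      (Functor.mapTriangleIso (toTacCompι C)).app _ ≪≫
      (Functor.mapTriangleCompIso (resolutionι C) (HomotopyCategory.quotient C _)).app _ ≪≫
      (HomotopyCategory.quotient C _).mapTriangle.mapIso (mapSplitTriangleIso T σ)⟩⟩

lemma resolutionCycles_map_splitTriangle_distinguished :
    (resolutionCycles C).mapTriangle.obj (splitTriangle T σ) ∈ distTriang (StableGP C) :=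
  isomorphic_distinguished _ ((stableCycles C).map_distinguished _
    (toTac_map_splitTriangle_distinguished T σ)) _
    ((Functor.mapTriangleIso (toTacCompStableCycles C)).symm.app _ ≪≫
      (Functor.mapTriangleCompIso (toTac C) (stableCycles C)).app _)

/-- The cycles of a degreewise split sequence of complete projective resolutions. -/
abbrev cyclesShortComplexGP : ShortComplex (GP C).FullSubcategory := T.map (cyclesGP C 0)

include σ in
lemma cyclesShortComplexGP_shortExact : ((cyclesShortComplexGP T).map (GP C).ι).ShortExact :=
  shortExact_cycles_of_degreewiseSplit σ T.X₃.property.acyclic 0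

lemma shiftCompCyclesGP_hom_app_hom (K : CompleteResolution C) :
    ((shiftCompCyclesGP C).hom.app K).hom =
      cyclesMap (L := K.obj⟦(1 : ℤ)⟧) (((resolutionι C).commShiftIso (1 : ℤ)).hom.app K) 0 ≫
        (cyclesShiftIso K.obj 1 0 1 (add_zero 1)).hom :=
  (GP C).ι.map_preimage (X := (cyclesGP C 0).obj (K⟦(1 : ℤ)⟧)) (Y := (cyclesGP C 1).obj K) _

lemma splitHom_comp_shiftCompCyclesGP_hom :
    ((cyclesGP C 0).map (splitHom T σ) ≫ (shiftCompCyclesGP C).hom.app T.X₁).hom =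
      cyclesMap (homOfDegreewiseSplit (T.map (resolutionι C)) σ) 0 ≫
        (cyclesShiftIso T.X₁.obj 1 0 1 (add_zero 1)).hom :=
  (congrArg (cyclesMap (splitHom T σ).hom 0 ≫ ·) (shiftCompCyclesGP_hom_app_hom T.X₁)).trans
    ((Category.assoc _ _ _).symm.trans (congrArg (· ≫ (cyclesShiftIso T.X₁.obj 1 0 1 _).hom)
      ((cyclesMap_comp _ _ _).symm.trans (congrArg (cyclesMap · 0)
        (splitHom_hom_comp_commShiftIso_hom T σ)))))

omit T σ in
lemma exists_cycles_retraction (S : ShortComplex (CochainComplex C ℤ))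
    (σ : ∀ n, (S.map (eval C _ n)).Splitting) :
    ∃ g : S.X₂.cycles 0 ⟶ S.X₁.X 0, cyclesMap S.f 0 ≫ g = S.X₁.iCycles 0 ∧
      cyclesMap S.g 0 ≫ cyclesMap (homOfDegreewiseSplit S σ) 0 ≫
        (cyclesShiftIso S.X₁ 1 0 1 (add_zero 1)).hom = -(g ≫ S.X₁.toCycles 0 1) := by
  let r (n : ℤ) : S.X₂.X n ⟶ S.X₁.X n := (σ n).r
  let s (n : ℤ) : S.X₃.X n ⟶ S.X₂.X n := (σ n).s
  have f_r : S.f.f 0 ≫ r 0 = 𝟙 _ := (σ 0).f_r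
  have f_r' : S.f.f 1 ≫ r 1 = 𝟙 _ := (σ 1).f_r
  have hid : r 0 ≫ S.f.f 0 + S.g.f 0 ≫ s 0 = 𝟙 _ := (σ 0).id
  have hσ : (homOfDegreewiseSplit S σ).f 0 ≫ (S.X₁.shiftFunctorObjXIso 1 0 1 (by lia)).hom =
      s 0 ≫ S.X₂.d 0 1 ≫ r 1 := (Category.comp_id _).trans (homOfDegreewiseSplit_f S σ 0)
  have h0 : S.X₂.iCycles 0 ≫ (r 0 ≫ S.f.f 0 + S.g.f 0 ≫ s 0) ≫ S.X₂.d 0 1 ≫ r 1 = 0 := by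
    rw [hid, Category.id_comp, iCycles_d_assoc, zero_comp]
  refine ⟨S.X₂.iCycles 0 ≫ r 0, by rw [cyclesMap_i_assoc, f_r, Category.comp_id], ?_⟩
  rw [← cancel_mono (S.X₁.iCycles 1), Preadditive.neg_comp, Category.assoc, Category.assoc,
    Category.assoc, Category.assoc, cyclesShiftIso_hom_iCycles, cyclesMap_i_assoc, hσ,
    cyclesMap_i_assoc, toCycles_i]
  rw [Preadditive.add_comp, Preadditive.comp_add, Category.assoc, S.f.comm_assoc, f_r',
    Category.comp_id, Category.assoc] at h0
  exact eq_neg_of_add_eq_zero_right h0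

lemma connectingHom_cyclesShortComplexGP :
    connectingHom (cyclesShortComplexGP T) (cyclesShortComplexGP_shortExact T σ) =
      (resolutionCycles C).map (splitHom T σ) ≫
        ((resolutionCycles C).commShiftIso (1 : ℤ)).hom.app T.X₁ := by
  obtain ⟨g, hg, hg'⟩ := exists_cycles_retraction (T.map (resolutionι C)) σ
  have hh := congrArg (cyclesMap T.g.hom 0 ≫ ·) (splitHom_comp_shiftCompCyclesGP_hom T σ)
  let D : ConnectingData (cyclesShortComplexGP T) :=
    { K := T.X₁
      e := Iso.refl _
      g := g
      h := -((cyclesGP C 0).map (splitHom T σ) ≫ (shiftCompCyclesGP C).hom.app T.X₁)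
      comm₁ := hg.trans (Category.id_comp _).symm
      comm₂ := (Preadditive.comp_neg _ _).trans (neg_eq_iff_eq_neg.2 (hh.trans hg')) }
  have hδ : -((toStable C).map (-((cyclesGP C 0).map (splitHom T σ) ≫
      (shiftCompCyclesGP C).hom.app T.X₁)) ≫ (shiftCyclesIso C).inv.app T.X₁) =
      (resolutionCycles C).map (splitHom T σ) ≫
        ((resolutionCycles C).commShiftIso (1 : ℤ)).hom.app T.X₁ := by
    have h₁ : (toStable C).map ((shiftCompCyclesGP C).hom.app T.X₁) ≫
        (shiftCyclesIso C).inv.app T.X₁ =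
        ((resolutionCycles C).commShiftIso (1 : ℤ)).hom.app T.X₁ :=
      (toStable C).mapIso ((shiftCompCyclesGP C).app T.X₁) |>.hom_inv_id_assoc _
    rw [Functor.map_neg, Preadditive.neg_comp, neg_neg, Functor.map_comp, Category.assoc, h₁]
    rfl
  rw [connectingHom_eq _ D, ← hδ]
  refine congrArg (- ((toStable C).map D.h ≫ ·)) ?_
  exact (congrArg (_ ≫ ·) ((congrArg (·⟦(1 : ℤ)⟧') ((toStable C).map_id _)).trans
    (CategoryTheory.Functor.map_id _ _))).trans (Category.comp_id _)

/-- The triangle of the cycles of a degreewise split sequence is induced by the triangle of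
complexes. -/
def mapSplitTriangleCyclesIso : (resolutionCycles C).mapTriangle.obj (splitTriangle T σ) ≅
    stableTriangle (cyclesShortComplexGP T) (cyclesShortComplexGP_shortExact T σ) :=
  Triangle.isoMk _ _ (Iso.refl _) (Iso.refl _) (Iso.refl _)
    ((Category.comp_id _).trans (Category.id_comp _).symm)
    ((Category.comp_id _).trans (Category.id_comp _).symm)
    ((congrArg (_ ≫ ·) (CategoryTheory.Functor.map_id _ _)).trans ((Category.comp_id _).trans
      ((connectingHom_cyclesShortComplexGP T σ).symm.trans (Category.id_comp _).symm)))

omit T σ in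
lemma stableTriangle_distinguished (S : ShortComplex (GP C).FullSubcategory)
    (hS : (S.map (GP C).ι).ShortExact) : stableTriangle S hS ∈ distTriang (StableGP C) := by
  obtain ⟨T, σ, hT₁, hT₃, ⟨e⟩⟩ := exists_degreewiseSplit_iso_cycles hS S.X₁.property S.X₃.property
  let T' : ShortComplex (CompleteResolution C) :=
    { X₁ := ⟨T.X₁, hT₁⟩
      X₂ := ⟨T.X₂, .of_degreewiseSplit σ hT₁ hT₃⟩
      X₃ := ⟨T.X₃, hT₃⟩
      f := ObjectProperty.homMk T.f
      g := ObjectProperty.homMk T.g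
      zero := ObjectProperty.hom_ext _ T.zero }
  let e' : S ≅ cyclesShortComplexGP T' :=
    ShortComplex.isoMk ((GP C).isoMk (ShortComplex.π₁.mapIso e))
      ((GP C).isoMk (ShortComplex.π₂.mapIso e)) ((GP C).isoMk (ShortComplex.π₃.mapIso e))
      (ObjectProperty.hom_ext _ e.hom.comm₁₂) (ObjectProperty.hom_ext _ e.hom.comm₂₃)
  exact isomorphic_distinguished _ (resolutionCycles_map_splitTriangle_distinguished T' σ) _
    (stableTriangleIso hS (cyclesShortComplexGP_shortExact T' σ) e' ≪≫
      (mapSplitTriangleCyclesIso T' σ).symm)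

omit T σ in
/-- The middle object is the sum of `Y` with a projective object. -/
lemma exists_shortExact_iso {X Y : (GP C).FullSubcategory} (f : X ⟶ Y) :
    ∃ (S : ShortComplex (GP C).FullSubcategory) (_ : (S.map (GP C).ι).ShortExact)
      (e₁ : S.X₁ ≅ X) (e₂ : (toStable C).obj S.X₂ ≅ (toStable C).obj Y),
      (toStable C).map S.f ≫ e₂.hom = (toStable C).map (e₁.hom ≫ f) := by
  obtain ⟨P, ι, hP, hι, hG⟩ := X.property.exists_embedding
  have hS := shortComplex_mk_cokernel_shortExact ι
  have sq := (IsPushout.of_hasPushout ι f.hom).flip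
  let Z : (GP C).FullSubcategory :=
    ⟨Y.obj ⊞ P, Y.property.biprod (GP.of_shortExact hS X.property hG)⟩
  have hQ := GP.of_shortExact (pushoutShortComplex_shortExact hS f.hom) Y.property hG
  let S : ShortComplex (GP C).FullSubcategory :=
    { X₁ := X
      X₂ := Z
      X₃ := ⟨_, hQ⟩
      f := ObjectProperty.homMk sq.shortComplex.f
      g := ObjectProperty.homMk sq.shortComplex.g
      zero := ObjectProperty.hom_ext _ sq.shortComplex.zero }
  let r : Z ⟶ Y := ObjectProperty.homMk biprod.fst
  let s : Y ⟶ Z := ObjectProperty.homMk biprod.inl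
  have hSf : biprod.lift f.hom (-ι) ≫ (-biprod.snd) = ι := by
    rw [Preadditive.comp_neg, biprod.lift_snd, neg_neg]
  have : Mono (biprod.lift f.hom (-ι)) := mono_of_mono_fac hSf
  refine ⟨S, ?_, Iso.refl X, (toStableIso s r (ObjectProperty.hom_ext _ biprod.inl_fst)
    (biprod.snd : Y.obj ⊞ P ⟶ P) biprod.inr biprod.total).symm, ?_⟩
  · exact { exact := sq.exact_shortComplex
            mono_f := this
            epi_g := sq.epi_shortComplex_g }
  · have hSr : S.f ≫ r = f := ObjectProperty.hom_ext _ (biprod.lift_fst _ _)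
    exact ((toStable C).map_comp _ _).symm.trans (congrArg (toStable C).map
      (hSr.trans (Category.id_comp _).symm))

variable (C) in
/-- The triangulated structure of the stable category. -/
abbrev stableTriangulation : StableTriangulation C where
  δ := connectingHom
  δ_naturality := connectingHom_naturality
  distinguished_iff T := by
    refine ⟨fun hT => ?_, fun ⟨S, hS, ⟨e⟩⟩ =>
      isomorphic_distinguished _ (stableTriangle_distinguished S hS) _ e⟩
    obtain ⟨f, hf⟩ := (toStable C).map_surjective (X := T.obj₁.as) (Y := T.obj₂.as) T.mor₁
    obtain ⟨S, hS, e₁, e₂, h⟩ := exists_shortExact_iso f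
    refine ⟨S, hS, ⟨(isoTriangleOfIso₁₂ _ _ (stableTriangle_distinguished S hS) hT
      ((toStable C).mapIso e₁) e₂ ?_).symm⟩⟩
    exact h.trans (((toStable C).map_comp _ _).trans (congrArg (_ ≫ ·) hf))

end Triangulation

section StableMap

open scoped StableShift

variable {C : Type u₁} [Category.{v₁} C] [Abelian C] {D : Type u₂} [Category.{v₂} D] [Abelian D]

open HomologicalComplex

/-- The contractible complex `⋯ ⟶ Q ⊞ Q ⟶ Q ⊞ Q ⟶ ⋯`, for the differential sending the first
summand to the second one. -/
def periodicComplex (Q : C) : CochainComplex C ℤ where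
  X _ := Q ⊞ Q
  d i j := if i + 1 = j then biprod.fst ≫ biprod.inr else 0
  shape _ _ h := if_neg h
  d_comp_d' _ _ _ _ _ := by split_ifs <;> simp

/-- The contraction of `periodicComplex Q` sends the second summand to the first one. -/
def periodicComplexHomotopy (Q : C) : Homotopy (𝟙 (periodicComplex Q)) 0 where
  hom i j := if j + 1 = i then biprod.snd ≫ biprod.inl else (0 : Q ⊞ Q ⟶ Q ⊞ Q)
  zero _ _ h := if_neg h
  comm n := by
    rw [dNext_eq _ (show (ComplexShape.up ℤ).Rel n (n + 1) from rfl),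
      prevD_eq _ (show (ComplexShape.up ℤ).Rel (n - 1) n from sub_add_cancel n 1),
      zero_f, add_zero]
    simp only [periodicComplex, sub_add_cancel, if_true, Category.assoc, biprod.inr_snd_assoc,
      biprod.inl_fst_assoc]
    exact biprod.total.symm

lemma periodicComplex_isCompleteProjectiveResolution (Q : C) [Projective Q] :
    IsCompleteProjectiveResolution (periodicComplex Q) :=
  isCompleteProjectiveResolution_of_homotopy
    (fun _ => inferInstanceAs (Projective (Q ⊞ Q))) (periodicComplexHomotopy Q)

section Map

variable (φ : C ⥤ D) [φ.Additive]

/-- The image of a complex under an additive functor. -/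
abbrev mapComplex (K : CochainComplex C ℤ) : CochainComplex D ℤ :=
  (φ.mapHomologicalComplex (ComplexShape.up ℤ)).obj K

/-- The inclusion of the cycles of the image of a complex. -/
def mapICycles (K : CochainComplex C ℤ) (n : ℤ) : (mapComplex φ K).cycles n ⟶ φ.obj (K.X n) :=
  (mapComplex φ K).iCycles n

/-- The differential of the image of a complex, as a morphism to the cycles. -/
def mapToCycles (K : CochainComplex C ℤ) (m n : ℤ) : φ.obj (K.X m) ⟶ (mapComplex φ K).cycles n :=
  (mapComplex φ K).toCycles m n

instance (K : CochainComplex C ℤ) (n : ℤ) : Mono (mapICycles φ K n) :=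
  inferInstanceAs (Mono ((mapComplex φ K).iCycles n))

lemma mapToCycles_mapICycles (K : CochainComplex C ℤ) (m n : ℤ) :
    mapToCycles φ K m n ≫ mapICycles φ K n = φ.map (K.d m n) :=
  (mapComplex φ K).toCycles_i m n

lemma mapICycles_naturality {K L : CochainComplex C ℤ} (f : K ⟶ L) (n : ℤ) :
    cyclesMap ((φ.mapHomologicalComplex (ComplexShape.up ℤ)).map f) n ≫ mapICycles φ L n =
      mapICycles φ K n ≫ φ.map (f.f n) :=
  cyclesMap_i _ _

/-- The canonical morphism from the image of the cycles to the cycles of the image. -/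
def mapCyclesHom (K : CochainComplex C ℤ) (n : ℤ) :
    φ.obj (K.cycles n) ⟶ (mapComplex φ K).cycles n :=
  (mapComplex φ K).liftCycles (φ.map (K.iCycles n)) (n + 1) (by simp)
    ((φ.map_comp _ _).symm.trans ((congrArg φ.map (K.iCycles_d _ _)).trans (φ.map_zero _ _)))

lemma mapCyclesHom_mapICycles (K : CochainComplex C ℤ) (n : ℤ) :
    mapCyclesHom φ K n ≫ mapICycles φ K n = φ.map (K.iCycles n) :=
  liftCycles_i _ _ _ _ _

lemma map_toCycles_mapCyclesHom (K : CochainComplex C ℤ) (m n : ℤ) :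
    φ.map (K.toCycles m n) ≫ mapCyclesHom φ K n = mapToCycles φ K m n := by
  rw [← cancel_mono (mapICycles φ K n), Category.assoc, mapCyclesHom_mapICycles, ← φ.map_comp,
    toCycles_i, mapToCycles_mapICycles]

lemma mapCyclesHom_naturality {K L : CochainComplex C ℤ} (f : K ⟶ L) (n : ℤ) :
    φ.map (cyclesMap f n) ≫ mapCyclesHom φ L n =
      mapCyclesHom φ K n ≫ cyclesMap ((φ.mapHomologicalComplex (ComplexShape.up ℤ)).map f) n := by
  rw [← cancel_mono (mapICycles φ L n), Category.assoc, Category.assoc, mapCyclesHom_mapICycles,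
    mapICycles_naturality, ← φ.map_comp, cyclesMap_i, φ.map_comp, ← mapCyclesHom_mapICycles,
    Category.assoc]

lemma isIso_mapCyclesHom [φ.PreservesEpimorphisms] {K : CochainComplex C ℤ} (hK : K.Acyclic)
    (hφK : (mapComplex φ K).Acyclic) (n : ℤ) : IsIso (mapCyclesHom φ K n) := by
  have := epi_toCycles hK (n - 1) n (by simp)
  have : Epi (mapToCycles φ K (n - 1) n) := epi_toCycles hφK (n - 1) n (by simp)
  have h : mapICycles φ K (n - 1) ≫ φ.map (K.toCycles (n - 1) n) = 0 := by
    have : Epi (mapToCycles φ K (n - 1 - 1) (n - 1)) := epi_toCycles hφK _ _ (by simp)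
    rw [← cancel_epi (mapToCycles φ K (n - 1 - 1) (n - 1)), reassoc_of% mapToCycles_mapICycles,
      ← φ.map_comp, d_toCycles, φ.map_zero, comp_zero]
  obtain ⟨r, hr⟩ : ∃ r, mapToCycles φ K (n - 1) n ≫ r = φ.map (K.toCycles (n - 1) n) :=
    exists_toCycles_comp_eq hφK (n - 1) n (by simp) _ h
  refine ⟨r, ?_, ?_⟩
  · rw [← cancel_epi (φ.map (K.toCycles (n - 1) n)), reassoc_of% map_toCycles_mapCyclesHom, hr,
      Category.comp_id]
  · rw [← cancel_epi (mapToCycles φ K (n - 1) n), reassoc_of% hr, map_toCycles_mapCyclesHom,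
      Category.comp_id]

lemma mono_map_iCycles [φ.PreservesEpimorphisms] {K : CochainComplex C ℤ} (hK : K.Acyclic)
    (hφK : (mapComplex φ K).Acyclic) (n : ℤ) : Mono (φ.map (K.iCycles n)) := by
  have := isIso_mapCyclesHom φ hK hφK n
  rw [← mapCyclesHom_mapICycles]
  infer_instance

/-- A functor sends complete projective resolutions to complete projective resolutions. -/
def PreservesCompleteResolutions (φ : C ⥤ D) [φ.Additive] : Prop :=
  ∀ K : CochainComplex C ℤ, IsCompleteProjectiveResolution K →
    IsCompleteProjectiveResolution (mapComplex φ K)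

namespace PreservesCompleteResolutions

variable {φ} (hφ : PreservesCompleteResolutions φ)
include hφ

lemma projective_obj (Q : C) [Projective Q] : Projective (φ.obj Q) := by
  have : Projective (φ.obj (Q ⊞ Q)) :=
    (hφ _ (periodicComplex_isCompleteProjectiveResolution Q)).projective 0
  exact Retract.projective (Y := φ.obj (Q ⊞ Q))
    { i := φ.map biprod.inl
      r := φ.map biprod.fst
      retract := by rw [← φ.map_comp, biprod.inl_fst, φ.map_id] }

lemma GP_obj [φ.PreservesEpimorphisms] (X : C) (hX : GP C X) : GP D (φ.obj X) := by
  obtain ⟨K, hK, ⟨e⟩⟩ := (GP_iff_exists_iso_cycles _ 0).1 hX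
  have := isIso_mapCyclesHom φ hK.acyclic (hφ K hK).acyclic 0
  exact (GP_iff_exists_iso_cycles _ 0).2
    ⟨_, hφ K hK, ⟨φ.mapIso e ≪≫ asIso (mapCyclesHom φ K 0)⟩⟩

/-- The functor on complete projective resolutions. -/
def mapResolution : CompleteResolution C ⥤ CompleteResolution D :=
  ObjectProperty.lift (D := CochainComplex D ℤ) IsCompleteProjectiveResolution
    (resolutionι C ⋙ φ.mapHomologicalComplex (ComplexShape.up ℤ)) fun K => hφ _ K.property

/-- The functor on homotopy categories of complete projective resolutions. -/
def mapTac : Tac C ⥤ Tac D :=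
  (tac D).lift ((tac C).ι ⋙ φ.mapHomotopyCategory (ComplexShape.up ℤ)) fun K => hφ _ K.property

/-- `mapTac` is the restriction of the functor between homotopy categories. -/
def mapTacCompι : hφ.mapTac ⋙ (tac D).ι ≅ (tac C).ι ⋙ φ.mapHomotopyCategory _ :=
  Iso.refl _

instance : hφ.mapTac.CommShift ℤ := .ofComp hφ.mapTacCompι ℤ

instance : NatTrans.CommShift hφ.mapTacCompι.hom ℤ := Functor.CommShift.ofComp_compatibility _ _

instance : hφ.mapTac.IsTriangulated := by
  rw [Functor.isTriangulated_iff_comp_right hφ.mapTacCompι]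
  infer_instance

variable [φ.PreservesEpimorphisms]

/-- The functor between stable categories induced by a functor which preserves complete projective
resolutions. -/
def stableMap : StableGP C ⥤ StableGP D :=
  CategoryTheory.Quotient.lift (stableRel C) (restrictGP φ hφ.GP_obj ⋙ toStable D) (by
    rintro X Y f g ⟨P, _, a, b, h⟩
    have := hφ.projective_obj P
    refine toStable_map_eq_of_factor _ _ (φ.map a) (φ.map b) ?_
    exact φ.map_sub.symm.trans ((congrArg φ.map h).trans (φ.map_comp _ _)))

/-- `stableMap` is induced by `φ`. -/
def toStableCompStableMap :
    toStable C ⋙ hφ.stableMap ≅ restrictGP φ hφ.GP_obj ⋙ toStable D :=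
  CategoryTheory.Quotient.lift.isLift _ _ _

lemma isInducedBy_stableMap : IsInducedBy hφ.stableMap φ :=
  ⟨hφ.GP_obj, ⟨hφ.toStableCompStableMap⟩⟩

/-- The compatibility of `φ` with the cycles of complete projective resolutions. -/
def cyclesGPCompIso :
    cyclesGP C 0 ⋙ restrictGP φ hφ.GP_obj ≅ hφ.mapResolution ⋙ cyclesGP D 0 :=
  NatIso.ofComponents
    (fun K => (GP D).isoMk
      (@asIso _ _ _ _ (mapCyclesHom φ K.obj 0)
        (isIso_mapCyclesHom φ K.property.acyclic (hφ _ K.property).acyclic 0)))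
    fun f => ObjectProperty.hom_ext _ (mapCyclesHom_naturality φ f.hom 0)

/-- The compatibility of `stableMap` and `mapTac`. -/
def stableCyclesCompStableMap : stableCycles C ⋙ hφ.stableMap ≅ hφ.mapTac ⋙ stableCycles D :=
  NatIso.ofComponents
    (fun K => (toStable D).mapIso (hφ.cyclesGPCompIso.app K.resolution)) fun {K L} f => by
      have h : (hφ.mapTac ⋙ stableCycles D).map f =
        (resolutionCycles D).map (hφ.mapResolution.map (Tac.representative f)) :=
        resolutionCycles_map_representative _ _
          (congrArg hφ.mapTac.map (toTac_map_representative f))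
      rw [h]
      exact ((toStable D).map_comp _ _).symm.trans ((congrArg (toStable D).map
        (hφ.cyclesGPCompIso.hom.naturality (Tac.representative f))).trans
          ((toStable D).map_comp _ _))

open MorphismProperty

/-- `stableMap` as the localization of `mapTac`. -/
@[reducible]
def stableMapLifting : Localization.Lifting (stableCycles C) (isomorphisms (Tac C))
    (hφ.mapTac ⋙ stableCycles D) hφ.stableMap :=
  ⟨hφ.stableCyclesCompStableMap⟩

instance stableMapCommShift : hφ.stableMap.CommShift ℤ :=
  let := hφ.stableMapLifting
  Functor.commShiftOfLocalization (stableCycles C) (isomorphisms (Tac C)) ℤ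
    (hφ.mapTac ⋙ stableCycles D) hφ.stableMap

instance : hφ.stableMap.IsTriangulated := by
  let := hφ.stableMapLifting
  have : NatTrans.CommShift hφ.stableCyclesCompStableMap.hom ℤ :=
    NatTrans.commShift_iso_hom_of_localization (stableCycles C) (isomorphisms (Tac C)) ℤ
      (hφ.mapTac ⋙ stableCycles D) hφ.stableMap
  have : (stableCycles C).mapArrow.EssSurj :=
    Localization.essSurj_mapArrow (stableCycles C) (isomorphisms (Tac C))
  exact Functor.isTriangulated_of_precomp_iso hφ.stableCyclesCompStableMap

section Adjunction

variable {ψ : D ⥤ C} [ψ.Additive] [ψ.PreservesEpimorphisms] (hψ : PreservesCompleteResolutions ψ)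
include hψ

/-- The adjunction between stable categories induced by an adjunction. -/
def stableAdjunction (adj : φ ⊣ ψ) : hφ.stableMap ⊣ hψ.stableMap where
  unit :=
    { app X := (toStable C).map (X := X.as) (Y := ⟨_, hψ.GP_obj _ (hφ.GP_obj _ X.as.property)⟩)
        (ObjectProperty.homMk (adj.unit.app X.as.obj))
      naturality X Y f := by
        obtain ⟨f, rfl⟩ := (toStable C).map_surjective (X := X.as) (Y := Y.as) f
        refine ((toStable C).map_comp _ _).symm.trans (Eq.trans ?_ ((toStable C).map_comp _ _))
        exact congrArg (toStable C).map (ObjectProperty.hom_ext _ (adj.unit.naturality f.hom)) }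
  counit :=
    { app X := (toStable D).map (X := ⟨_, hφ.GP_obj _ (hψ.GP_obj _ X.as.property)⟩) (Y := X.as)
        (ObjectProperty.homMk (adj.counit.app X.as.obj))
      naturality X Y f := by
        obtain ⟨f, rfl⟩ := (toStable D).map_surjective (X := X.as) (Y := Y.as) f
        refine ((toStable D).map_comp _ _).symm.trans (Eq.trans ?_ ((toStable D).map_comp _ _))
        exact congrArg (toStable D).map (ObjectProperty.hom_ext _ (adj.counit.naturality f.hom)) }
  left_triangle_components X :=
    ((toStable D).map_comp _ _).symm.trans ((congrArg (toStable D).map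
      (ObjectProperty.hom_ext _ (adj.left_triangle_components X.as.obj))).trans
        ((toStable D).map_id _))
  right_triangle_components X :=
    ((toStable C).map_comp _ _).symm.trans ((congrArg (toStable C).map
      (ObjectProperty.hom_ext _ (adj.right_triangle_components X.as.obj))).trans
        ((toStable C).map_id _))

end Adjunction

end PreservesCompleteResolutions

end Map

end StableMap

section HomExact

open HomologicalComplex

variable {C : Type u} [Category.{v} C] [Abelian C] {K : CochainComplex C ℤ}

lemma homExact_of_injective (hK : K.Acyclic) (I : C) [Injective I] : HomExact K I := by
  intro n f hf
  have hex := (exactAt_iff' _ (n - 1) n (n + 1) (by simp) (by simp)).1 (hK n)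
  exact ⟨hex.descToInjective f hf, hex.comp_descToInjective f hf⟩

lemma HomExact.of_shortExact (hK : ∀ n, Projective (K.X n)) {S : ShortComplex C}
    (hS : S.ShortExact) (h₂ : HomExact K S.X₂) (h₃ : HomExact K S.X₃) : HomExact K S.X₁ := by
  intro n f hf
  have := hS.mono_f
  have := hS.epi_g
  obtain ⟨g, hg⟩ := h₂ n (f ≫ S.f) (by rw [reassoc_of% hf, zero_comp])
  obtain ⟨h, hh⟩ := h₃.exists_desc n (n + 1) (n + 1 + 1) rfl rfl (g ≫ S.g)
    (by rw [reassoc_of% hg, S.zero, comp_zero])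
  have := hK (n + 1 + 1)
  have h' : (g - K.d (n + 1) (n + 1 + 1) ≫ Projective.factorThru h S.g) ≫ S.g = 0 := by
    rw [Preadditive.sub_comp, Category.assoc, Projective.factorThru_comp, hh, sub_self]
  refine ⟨hS.exact.lift _ h', ?_⟩
  rw [← cancel_mono S.f, Category.assoc, hS.exact.lift_f, Preadditive.comp_sub, hg,
    K.d_comp_d_assoc, zero_comp, sub_zero]

lemma homExact_of_hasInjectiveDimensionLE [EnoughInjectives C]
    (hK : ∀ n, Projective (K.X n)) (hK' : K.Acyclic) (n : ℕ) (X : C)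
    (hX : HasInjectiveDimensionLE X n) : HomExact K X := by
  induction n generalizing X with
  | zero =>
    have : Injective X := injective_iff_hasInjectiveDimensionLT_one.2 hX
    exact homExact_of_injective hK' X
  | succ n hn =>
    let S : ShortComplex C := ShortComplex.mk (Injective.ι X) (cokernel.π (Injective.ι X)) (by simp)
    have hS : S.ShortExact := { exact := ShortComplex.exact_cokernel _ }
    have : Injective S.X₂ := inferInstanceAs (Injective (Injective.under X))
    exact HomExact.of_shortExact hK hS (homExact_of_injective hK' _)
      (hn _ ((hS.hasInjectiveDimensionLT_X₃_iff n inferInstance).2 hX))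

lemma IsGorenstein.isCompleteProjectiveResolution (hC : IsGorenstein C)
    (hK : ∀ n, Projective (K.X n)) (hK' : K.Acyclic) : IsCompleteProjectiveResolution K where
  projective := hK
  acyclic := hK'
  homExact P hP := by
    have := hC.enoughInjectives
    obtain ⟨n, hn⟩ := hC.injectiveDimension
    exact homExact_of_hasInjectiveDimensionLE hK hK' n P (hn P hP)

lemma acyclic_of_shortExact {S : ShortComplex (CochainComplex C ℤ)} (hS : S.ShortExact)
    (h₁ : S.X₁.Acyclic) (h₂ : S.X₂.Acyclic) : S.X₃.Acyclic :=
  hS.acyclic_X₃ ⟨fun i => (quasiIsoAt_iff_exactAt _ i (h₁ i)).2 (h₂ i)⟩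

lemma HomExact.map_of_adjunction {D : Type u₂} [Category.{v₂} D] [Abelian D] {φ : C ⥤ D}
    {ψ : D ⥤ C} [φ.Additive] [ψ.Additive] (adj : φ ⊣ ψ) {X : D} (h : HomExact K (ψ.obj X)) :
    HomExact (mapComplex φ K) X := by
  intro n f hf
  let f' : φ.obj (K.X n) ⟶ X := f
  have hf' : φ.map (K.d (n - 1) n) ≫ f' = 0 := hf
  obtain ⟨g, hg⟩ := h n (adj.homEquiv _ _ f') (by
    rw [← adj.homEquiv_naturality_left, hf', adj.homEquiv_unit, ψ.map_zero, comp_zero])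
  refine ⟨(adj.homEquiv _ _).symm g, ?_⟩
  refine (adj.homEquiv_naturality_left_symm (K.d n (n + 1)) g).symm.trans ?_
  rw [hg, Equiv.symm_apply_apply]

end HomExact

section Comma

variable {A : Type u₁} [Category.{v₁} A] {B : Type u₂} [Category.{v₂} B] {F : A ⥤ B}

lemma epi_of_components {W W' : LeftComma F} (f : W ⟶ W') [Epi f.left] [Epi f.right] : Epi f where
  left_cancellation g h hgh := by
    ext
    · rw [← cancel_epi f.left]
      exact congrArg (fun k => k.left) hgh
    · rw [← cancel_epi f.right]
      exact congrArg (fun k => k.right) hgh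

lemma mono_of_components {W W' : LeftComma F} (f : W ⟶ W') [Mono f.left] [Mono f.right] :
    Mono f where
  right_cancellation g h hgh := by
    ext
    · rw [← cancel_mono f.left]
      exact congrArg (fun k => k.left) hgh
    · rw [← cancel_mono f.right]
      exact congrArg (fun k => k.right) hgh

/-- The structure morphism of an object of the left comma category, with `W.right` instead of
`(𝟭 B).obj W.right` as its target. -/
def str (W : LeftComma F) : F.obj W.left ⟶ W.right := W.hom

/-- The morphism of the left comma category with given components, whose compatibility condition
does not mention `𝟭 B`. -/
def commaHom {W W' : LeftComma F} (a : W.left ⟶ W'.left) (b : W.right ⟶ W'.right)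
    (h : F.map a ≫ str W' = str W ≫ b) : W ⟶ W' where
  left := a
  right := b
  w := h

lemma str_naturality {W W' : LeftComma F} (f : W ⟶ W') :
    F.map f.left ≫ str W' = str W ≫ f.right := f.w

variable (F) in
/-- The functor `Y ↦ (Y, F Y)` is left adjoint to the first projection. -/
def freeAdjFst : freeFunctor F ⊣ Comma.fst F (𝟭 B) where
  unit :=
    { app X := 𝟙 X
      naturality _ _ f := (Category.comp_id f).trans (Category.id_comp f).symm }
  counit :=
    { app W := commaHom (W := (freeFunctor F).obj W.left) (𝟙 W.left) (str W)
        (congrArg (· ≫ str W) (F.map_id W.left))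
      naturality W W' f := by
        ext
        · exact (Category.comp_id f.left).trans (Category.id_comp f.left).symm
        · exact f.w }
  left_triangle_components X := by
    ext
    · exact Category.id_comp (𝟙 X)
    · exact (Category.comp_id _).trans (F.map_id _)
  right_triangle_components W := Category.id_comp (𝟙 W.left)

section

variable [Abelian B]

/-- The projection onto the cokernel of the structure morphism. -/
def cokerπ (W : LeftComma F) : W.right ⟶ (cokerFunctor F).obj W := cokernel.π W.hom

instance (W : LeftComma F) : Epi (cokerπ W) := inferInstanceAs (Epi (cokernel.π W.hom))

@[simp]
lemma str_cokerπ (W : LeftComma F) : str W ≫ cokerπ W = 0 := cokernel.condition W.hom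

/-- The morphism from the cokernel of the structure morphism induced by a morphism. -/
def cokerDesc (W : LeftComma F) {X : B} (f : W.right ⟶ X) (h : str W ≫ f = 0) :
    (cokerFunctor F).obj W ⟶ X := cokernel.desc W.hom f h

@[simp]
lemma cokerπ_cokerDesc (W : LeftComma F) {X : B} (f : W.right ⟶ X) (h : str W ≫ f = 0) :
    cokerπ W ≫ cokerDesc W f h = f := cokernel.π_desc _ _ _

lemma cokerπ_cokerDesc_assoc (W : LeftComma F) {X Y : B} (f : W.right ⟶ X) (h : str W ≫ f = 0)
    (g : X ⟶ Y) : cokerπ W ≫ cokerDesc W f h ≫ g = f ≫ g := by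
  rw [← Category.assoc, cokerπ_cokerDesc]

@[simp]
lemma cokerπ_naturality {W W' : LeftComma F} (f : W ⟶ W') :
    cokerπ W ≫ (cokerFunctor F).map f = f.right ≫ cokerπ W' := cokernel.π_desc _ _ _

lemma cokerπ_map_cokerDesc {W W' : LeftComma F} (f : W ⟶ W') {X : B} (g : W'.right ⟶ X)
    (h : str W' ≫ g = 0) :
    cokerπ W ≫ (cokerFunctor F).map f ≫ cokerDesc W' g h = f.right ≫ g := by
  rw [reassoc_of% cokerπ_naturality, cokerπ_cokerDesc]

variable (F) in
/-- The functor `Y ↦ (Y, 0)`. -/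
def zeroRightFunctor : A ⥤ LeftComma F where
  obj Y := { left := Y, right := 0, hom := 0 }
  map f := { left := f, right := 0, w := (isZero_zero B).eq_of_tgt _ _ }

variable (F) in
/-- The functor `Y ↦ (Y, 0)` is right adjoint to the first projection. -/
def fstAdjZeroRight : Comma.fst F (𝟭 B) ⊣ zeroRightFunctor F where
  unit :=
    { app W := commaHom (W' := (zeroRightFunctor F).obj W.left) (𝟙 W.left) 0
        ((isZero_zero B).eq_of_tgt _ _)
      naturality _ _ f := by
        ext
        · exact (Category.comp_id f.left).trans (Category.id_comp f.left).symm
        · exact (isZero_zero B).eq_of_tgt _ _ }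
  counit :=
    { app Y := 𝟙 Y
      naturality _ _ f := (Category.comp_id f).trans (Category.id_comp f).symm }
  left_triangle_components W := Category.id_comp (𝟙 W.left)
  right_triangle_components Y := by
    ext
    · exact Category.id_comp (𝟙 Y)
    · exact (isZero_zero B).eq_of_src _ _

instance : (zeroRightFunctor F).PreservesEpimorphisms where
  preserves f _ :=
    have : Epi ((zeroRightFunctor F).map f).left := inferInstanceAs (Epi f)
    have : Epi ((zeroRightFunctor F).map f).right := ⟨fun _ _ _ => (isZero_zero B).eq_of_src _ _⟩
    epi_of_components _

lemma projective_fst (W : LeftComma F) [hW : Projective W] : Projective W.left :=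
  (fstAdjZeroRight F).map_projective W hW

lemma projective_free (Q : A) [hQ : Projective Q] : Projective ((freeFunctor F).obj Q) :=
  have := Functor.preservesEpimorphisms_of_adjunction (fstAdjZeroRight F)
  (freeAdjFst F).map_projective Q hQ

lemma exists_retraction_of_projective (W : LeftComma F) [Projective W] :
    ∃ r : W.right ⟶ F.obj W.left, str W ≫ r = 𝟙 _ := by
  let V : LeftComma F := { left := W.left, right := F.obj W.left ⊞ W.right, hom := biprod.inl }
  let p : V ⟶ W := commaHom (𝟙 W.left) (biprod.desc (str W) (𝟙 W.right)) (by
    rw [F.map_id, Category.id_comp]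
    exact (biprod.inl_desc _ _).symm)
  have : Epi p.left := inferInstanceAs (Epi (𝟙 _))
  have : Epi p.right := epi_of_epi_fac (biprod.inr_desc (str W) (𝟙 W.right))
  have : Epi p := epi_of_components p
  let s : W ⟶ V := Projective.factorThru (𝟙 W) p
  have hs : s ≫ p = 𝟙 W := Projective.factorThru_comp _ _
  have hl : s.left = 𝟙 W.left :=
    (Category.comp_id _).symm.trans (congrArg (fun k => k.left) hs)
  have hw : F.map s.left ≫ biprod.inl = str W ≫ s.right := str_naturality s
  rw [hl, F.map_id, Category.id_comp] at hw
  exact ⟨s.right ≫ biprod.fst, by rw [← reassoc_of% hw, biprod.inl_fst]⟩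

end

section

variable [Abelian A] [Abelian B] [F.Additive]

/-- The morphism from `(0, X)` with a given second component. -/
def fromZeroLeft {X : B} (W : LeftComma F) (a : X ⟶ W.right) : (zeroLeftFunctor F).obj X ⟶ W :=
  commaHom (W := (zeroLeftFunctor F).obj X) 0 a
    ((IsZero.of_iso (isZero_zero B) F.mapZeroObject).eq_of_src _ _)

variable (F) in
/-- The functor `X ↦ (0, X)` is left adjoint to the second projection. -/
def zeroLeftAdjSnd : zeroLeftFunctor F ⊣ Comma.snd F (𝟭 B) where
  unit :=
    { app X := 𝟙 X
      naturality _ _ f := (Category.comp_id f).trans (Category.id_comp f).symm }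
  counit :=
    { app W := fromZeroLeft W (𝟙 W.right)
      naturality _ _ f := by
        ext
        · exact (isZero_zero A).eq_of_src _ _
        · exact (Category.comp_id f.right).trans (Category.id_comp f.right).symm }
  left_triangle_components X := by
    ext
    · exact (isZero_zero A).eq_of_src _ _
    · exact Category.id_comp _
  right_triangle_components W := Category.id_comp _

variable (F) in
/-- The cokernel functor is left adjoint to `X ↦ (0, X)`. -/
def cokerAdjZeroLeft : cokerFunctor F ⊣ zeroLeftFunctor F where
  unit :=
    { app W := commaHom (W' := (zeroLeftFunctor F).obj ((cokerFunctor F).obj W))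
        0 (cokerπ W) (by
          rw [F.map_zero, zero_comp]
          exact (str_cokerπ W).symm)
      naturality _ _ f := by
        ext
        · exact (isZero_zero A).eq_of_tgt _ _
        · exact (cokerπ_naturality f).symm }
  counit :=
    { app X := cokerDesc ((zeroLeftFunctor F).obj X) (𝟙 X)
        ((IsZero.of_iso (isZero_zero B) F.mapZeroObject).eq_of_src _ _)
      naturality X X' f := by
        refine (cancel_epi (cokerπ ((zeroLeftFunctor F).obj X))).1
          ((cokerπ_map_cokerDesc _ _ _).trans ((Category.comp_id f).trans ?_))
        exact ((cokerπ_cokerDesc_assoc ((zeroLeftFunctor F).obj X) (𝟙 X) _ f).trans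
          (Category.id_comp f)).symm }
  left_triangle_components W :=
    (cancel_epi (cokerπ W)).1 (cokerπ_map_cokerDesc _ _ _)
  right_triangle_components X := by
    ext
    · exact (isZero_zero A).eq_of_src _ _
    · exact cokerπ_cokerDesc _ _ _

instance : (zeroLeftFunctor F).Additive where
  map_add := by
    intros
    ext
    · exact (isZero_zero A).eq_of_src _ _
    · rfl

instance : (freeFunctor F).Additive where
  map_add := by
    intros
    ext
    · rfl
    · exact F.map_add

instance : (cokerFunctor F).Additive where
  map_add := by
    intro W W' f g
    rw [← cancel_epi (cokerπ W), Preadditive.comp_add, cokerπ_naturality, cokerπ_naturality,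
      cokerπ_naturality, ← Preadditive.add_comp]
    rfl

instance : (zeroLeftFunctor F).PreservesEpimorphisms where
  preserves f _ :=
    have : Epi ((zeroLeftFunctor F).map f).left := ⟨fun _ _ _ => (isZero_zero A).eq_of_src _ _⟩
    have : Epi ((zeroLeftFunctor F).map f).right := inferInstanceAs (Epi f)
    epi_of_components _

instance : (cokerFunctor F).PreservesEpimorphisms :=
  Functor.preservesEpimorphisms_of_adjunction (cokerAdjZeroLeft F)

instance [F.PreservesEpimorphisms] : (freeFunctor F).PreservesEpimorphisms where
  preserves f _ :=
    have : Epi ((freeFunctor F).map f).left := inferInstanceAs (Epi f)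
    have : Epi ((freeFunctor F).map f).right := inferInstanceAs (Epi (F.map f))
    epi_of_components _

lemma isZero_of_components {W : LeftComma F} (h₁ : IsZero W.left) (h₂ : IsZero W.right) :
    IsZero W := by
  rw [IsZero.iff_id_eq_zero]
  ext
  · exact h₁.eq_of_src _ _
  · exact h₂.eq_of_src _ _

lemma projective_coker (W : LeftComma F) [hW : Projective W] :
    Projective ((cokerFunctor F).obj W) :=
  (cokerAdjZeroLeft F).map_projective W hW

lemma projective_snd (W : LeftComma F) [Projective W] [Projective (F.obj W.left)] :
    Projective W.right := by
  obtain ⟨r, hr⟩ := exists_retraction_of_projective W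
  have : Projective ((cokerFunctor F).obj W) := projective_coker W
  have h : str W ≫ (𝟙 W.right - r ≫ str W) = 0 := by
    rw [Preadditive.comp_sub, reassoc_of% hr, Category.comp_id, sub_self]
  exact Retract.projective (Y := F.obj W.left ⊞ (cokerFunctor F).obj W)
    { i := biprod.lift r (cokerπ W)
      r := biprod.desc (str W) (cokerDesc _ _ h)
      retract := by rw [biprod.lift_desc, cokerπ_cokerDesc, add_sub_cancel] }

end

section

variable [Abelian A] [Abelian B] [F.Additive] [PreservesFiniteColimits F]

instance : PreservesFiniteLimits (Comma.fst F (𝟭 B)) :=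
  ⟨fun J _ _ => preservesLimitsOfShape_fst F J⟩

instance : PreservesFiniteLimits (Comma.snd F (𝟭 B)) :=
  ⟨fun J _ _ => preservesLimitsOfShape_snd F J⟩

instance : PreservesFiniteColimits (Comma.fst F (𝟭 B)) where
  preservesFiniteColimits _ _ _ :=
    { preservesColimit :=
        preservesColimit_of_preserves_colimit_cocone
          (Comma.coconeOfPreservesIsColimit _ (colimit.isColimit _) (colimit.isColimit _))
          (colimit.isColimit _) }

instance : PreservesFiniteColimits (Comma.snd F (𝟭 B)) where
  preservesFiniteColimits _ _ _ :=
    { preservesColimit :=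
        preservesColimit_of_preserves_colimit_cocone
          (Comma.coconeOfPreservesIsColimit _ (colimit.isColimit _) (colimit.isColimit _))
          (colimit.isColimit _) }

lemma projective_zeroLeft (P : B) [hP : Projective P] : Projective ((zeroLeftFunctor F).obj P) :=
  (zeroLeftAdjSnd F).map_projective P hP

lemma exact_of_components {S : ShortComplex (LeftComma F)}
    (h₁ : (S.map (Comma.fst F (𝟭 B))).Exact) (h₂ : (S.map (Comma.snd F (𝟭 B))).Exact) :
    S.Exact := by
  rw [ShortComplex.exact_iff_isZero_homology] at h₁ h₂ ⊢
  exact isZero_of_components (h₁.of_iso (S.mapHomologyIso (Comma.fst F (𝟭 B))).symm)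
    (h₂.of_iso (S.mapHomologyIso (Comma.snd F (𝟭 B))).symm)

lemma shortExact_of_components {S : ShortComplex (LeftComma F)}
    (h₁ : (S.map (Comma.fst F (𝟭 B))).ShortExact) (h₂ : (S.map (Comma.snd F (𝟭 B))).ShortExact) :
    S.ShortExact where
  exact := exact_of_components h₁.exact h₂.exact
  mono_f :=
    have : Mono S.f.left := h₁.mono_f
    have : Mono S.f.right := h₂.mono_f
    mono_of_components _
  epi_g :=
    have : Epi S.g.left := h₁.epi_g
    have : Epi S.g.right := h₂.epi_g
    epi_of_components _

lemma acyclic_of_components {K : CochainComplex (LeftComma F) ℤ}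
    (h₁ : (mapComplex (Comma.fst F (𝟭 B)) K).Acyclic)
    (h₂ : (mapComplex (Comma.snd F (𝟭 B)) K).Acyclic) : K.Acyclic :=
  fun n => exact_of_components (h₁ n) (h₂ n)

lemma acyclic_fst {K : CochainComplex (LeftComma F) ℤ} (hK : K.Acyclic) :
    (mapComplex (Comma.fst F (𝟭 B)) K).Acyclic :=
  fun n => ShortComplex.Exact.map (hK n) (Comma.fst F (𝟭 B))

lemma acyclic_snd {K : CochainComplex (LeftComma F) ℤ} (hK : K.Acyclic) :
    (mapComplex (Comma.snd F (𝟭 B)) K).Acyclic :=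
  fun n => ShortComplex.Exact.map (hK n) (Comma.snd F (𝟭 B))

end

end Comma

section CompleteResolutions

variable {A : Type u₁} [Category.{v₁} A] [Abelian A] {B : Type u₂} [Category.{v₂} B] [Abelian B]
  {F : A ⥤ B} [F.Additive]

open HomologicalComplex

variable (F) in
/-- The condition (P1): `F` preserves the acyclicity of complexes of projective objects. -/
def PreservesAcyclicProjectives : Prop :=
  ∀ Q : CochainComplex A ℤ, (∀ n, Projective (Q.X n)) → Q.Acyclic → (mapComplex F Q).Acyclic

lemma IsPerfect.preservesCompleteResolutions (hF : IsPerfect F)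
    (hproj : F.PreservesProjectiveObjects) (hB : IsGorenstein B) :
    PreservesCompleteResolutions F := fun K hK =>
  hB.isCompleteProjectiveResolution (fun n => hproj.projective_obj (hK.projective n))
    (hF.acyclic_map K hK.projective hK.acyclic)

variable [PreservesFiniteColimits F]

variable (F) in
/-- The short complex formed by the structure morphisms of a complex and their cokernels. -/
def strShortComplex (K : CochainComplex (LeftComma F) ℤ) : ShortComplex (CochainComplex B ℤ) where
  X₁ := mapComplex F (mapComplex (Comma.fst F (𝟭 B)) K)
  X₂ := mapComplex (Comma.snd F (𝟭 B)) K
  X₃ := mapComplex (cokerFunctor F) K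
  f :=
    { f n := str (K.X n)
      comm' i j _ := (str_naturality (K.d i j)).symm }
  g :=
    { f n := cokerπ (K.X n)
      comm' i j _ := cokerπ_naturality (K.d i j) }
  zero := by
    ext n
    exact str_cokerπ (K.X n)

/-- For a complex of projective objects of the left comma category, `strShortComplex` splits in
each degree. -/
def strShortComplexSplitting {K : CochainComplex (LeftComma F) ℤ} [∀ n, Projective (K.X n)]
    (n : ℤ) : ((strShortComplex F K).map (eval B _ n)).Splitting :=
  .ofExactOfRetraction _ (ShortComplex.exact_cokernel (K.X n).hom)
    (exists_retraction_of_projective (K.X n)).choose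
    (exists_retraction_of_projective (K.X n)).choose_spec
    (inferInstanceAs (Epi (cokerπ (K.X n))))

lemma HomExact.fst {K : CochainComplex (LeftComma F) ℤ} [∀ n, Projective (K.X n)] {Q : A}
    (hK : HomExact K ((freeFunctor F).obj Q))
    (hcoker : HomExact (mapComplex (cokerFunctor F) K) (F.obj Q)) :
    HomExact (mapComplex (Comma.fst F (𝟭 B)) K) Q := by
  intro n f hf
  let f' : (K.X n).left ⟶ Q := f
  have hf' : (K.d (n - 1) n).left ≫ f' = 0 := hf
  obtain ⟨r, hr⟩ := exists_retraction_of_projective (K.X n)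
  -- `r ≫ F.map f'` extends `F.map f'` to `(K.X n).right`, but need not vanish on the differential:
  -- the defect comes from a morphism `c'` out of the cokernel.
  have h₁ : str (K.X (n - 1)) ≫ (K.d (n - 1) n).right ≫ r ≫ F.map f' = 0 := by
    rw [← reassoc_of% str_naturality, reassoc_of% hr, ← F.map_comp, hf', F.map_zero]
  obtain ⟨c', hc'⟩ : ∃ c' : (cokerFunctor F).obj (K.X n) ⟶ F.obj Q,
      (cokerFunctor F).map (K.d (n - 1) n) ≫ c' = cokerDesc _ _ h₁ := by
    refine hcoker.exists_desc (n - 1 - 1) (n - 1) n (by lia) (by lia) (cokerDesc _ _ h₁) ?_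
    have hdd : (K.d (n - 1 - 1) (n - 1)).right ≫ (K.d (n - 1) n).right = 0 :=
      congrArg (fun k => k.right) (K.d_comp_d (n - 1 - 1) (n - 1) n)
    refine (cancel_epi (cokerπ (K.X (n - 1 - 1)))).1
      ((cokerπ_map_cokerDesc (K.d (n - 1 - 1) (n - 1)) _ _).trans ?_)
    rw [reassoc_of% hdd, zero_comp]
    exact comp_zero.symm
  have h₂ : F.map f' ≫ str ((freeFunctor F).obj Q) =
      str (K.X n) ≫ (r ≫ F.map f' - cokerπ (K.X n) ≫ c') := by
    rw [Preadditive.comp_sub, reassoc_of% hr, reassoc_of% str_cokerπ, zero_comp, sub_zero]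
    exact Category.comp_id _
  obtain ⟨g, hg⟩ := hK n (commaHom f' _ h₂) (by
    ext
    · exact hf'
    · change (K.d (n - 1) n).right ≫ (r ≫ F.map f' - cokerπ (K.X n) ≫ c') = 0
      rw [Preadditive.comp_sub, ← reassoc_of% cokerπ_naturality, hc', cokerπ_cokerDesc, sub_self])
  exact ⟨g.left, congrArg (fun k => k.left) hg⟩

lemma acyclic_map_fst (hF : PreservesAcyclicProjectives F) {K : CochainComplex (LeftComma F) ℤ}
    (hK : IsCompleteProjectiveResolution K) :
    (mapComplex F (mapComplex (Comma.fst F (𝟭 B)) K)).Acyclic :=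
  hF _ (fun n => have := hK.projective n; projective_fst (K.X n)) (acyclic_fst hK.acyclic)

lemma free_preservesCompleteResolutions (hF : PreservesAcyclicProjectives F) :
    PreservesCompleteResolutions (freeFunctor F) := fun K hK =>
  { projective n := have := hK.projective n; projective_free (K.X n)
    acyclic := acyclic_of_components hK.acyclic (hF K hK.projective hK.acyclic)
    homExact W _ := HomExact.map_of_adjunction (freeAdjFst F)
      (hK.homExact W.left (projective_fst W)) }

lemma coker_preservesCompleteResolutions (hF : PreservesAcyclicProjectives F) :
    PreservesCompleteResolutions (cokerFunctor F) := fun K hK =>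
  { projective n := have := hK.projective n; projective_coker (K.X n)
    acyclic := acyclic_of_shortExact (shortExact_of_degreewise_shortExact _ fun n =>
      have := hK.projective; (strShortComplexSplitting n).shortExact) (acyclic_map_fst hF hK)
      (acyclic_snd hK.acyclic)
    homExact P _ := HomExact.map_of_adjunction (cokerAdjZeroLeft F)
      (hK.homExact _ (projective_zeroLeft P)) }

lemma zeroLeft_preservesCompleteResolutions (hF : PreservesCompleteResolutions F) :
    PreservesCompleteResolutions (zeroLeftFunctor F) := fun K hK =>
  { projective n := have := hK.projective n; projective_zeroLeft (K.X n)
    acyclic := acyclic_of_components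
      (fun _ => ShortComplex.exact_of_isZero_X₂ _ (isZero_zero A)) hK.acyclic
    homExact W _ :=
      have := projective_fst W
      have := hF.projective_obj W.left
      HomExact.map_of_adjunction (zeroLeftAdjSnd F) (hK.homExact W.right (projective_snd W)) }

lemma fst_preservesCompleteResolutions (hF : PreservesAcyclicProjectives F)
    (hF' : PreservesCompleteResolutions F) :
    PreservesCompleteResolutions (Comma.fst F (𝟭 B)) := fun K hK =>
  { projective n := have := hK.projective n; projective_fst (K.X n)
    acyclic := acyclic_fst hK.acyclic
    homExact Q _ :=
      have := hK.projective
      HomExact.fst (hK.homExact _ (projective_free Q))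
        ((coker_preservesCompleteResolutions hF K hK).homExact _ (hF'.projective_obj Q)) }

lemma snd_preservesCompleteResolutions (hF : PreservesAcyclicProjectives F)
    (hF' : PreservesCompleteResolutions F) :
    PreservesCompleteResolutions (Comma.snd F (𝟭 B)) := fun K hK =>
  have := hK.projective
  .of_degreewiseSplit strShortComplexSplitting
    (hF' _ (fst_preservesCompleteResolutions hF hF' K hK))
    (coker_preservesCompleteResolutions hF K hK)

end CompleteResolutions

section GorensteinProjectives

variable {A : Type u₁} [Category.{v₁} A] [Abelian A] {B : Type u₂} [Category.{v₂} B] [Abelian B]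
  {F : A ⥤ B} [F.Additive] [PreservesFiniteColimits F]

/-- The sequence `(Y, F Y) ⟶ (Y, X) ⟶ (0, Coker φ)`. -/
def strSequence (W : LeftComma F) : ShortComplex (LeftComma F) where
  X₁ := (freeFunctor F).obj W.left
  X₂ := W
  X₃ := (zeroLeftFunctor F).obj ((cokerFunctor F).obj W)
  f := (freeAdjFst F).counit.app W
  g := (cokerAdjZeroLeft F).unit.app W
  zero := by
    ext
    · exact (isZero_zero A).eq_of_tgt _ _
    · exact str_cokerπ W

lemma strSequence_shortExact (W : LeftComma F) [Mono W.hom] : (strSequence W).ShortExact := by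
  refine shortExact_of_components ?_ ?_
  · exact
      { exact := (ShortComplex.exact_iff_epi _ ((isZero_zero A).eq_of_tgt _ _)).2
          (inferInstanceAs (Epi (𝟙 W.left)))
        mono_f := inferInstanceAs (Mono (𝟙 W.left))
        epi_g := ⟨fun _ _ _ => (isZero_zero A).eq_of_src _ _⟩ }
  · exact
      { exact := ShortComplex.exact_cokernel W.hom
        mono_f := inferInstanceAs (Mono W.hom)
        epi_g := inferInstanceAs (Epi (cokerπ W)) }

lemma GP_of_components (hF : PreservesAcyclicProjectives F) (hF' : PreservesCompleteResolutions F)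
    (W : LeftComma F) (h₁ : GP A W.left) [Mono W.hom] (h₂ : GP B ((cokerFunctor F).obj W)) :
    GP (LeftComma F) W :=
  GP.of_shortExact (strSequence_shortExact W)
    ((free_preservesCompleteResolutions hF).GP_obj _ h₁)
    ((zeroLeft_preservesCompleteResolutions hF').GP_obj _ h₂)

lemma mono_hom_of_GP (hF : PreservesAcyclicProjectives F) {W : LeftComma F}
    (hW : GP (LeftComma F) W) : Mono (str W) := by
  obtain ⟨K, hK, ⟨e⟩⟩ := (GP_iff_exists_iso_cycles _ 0).1 hW
  let i : W ⟶ K.X 0 := e.hom ≫ K.iCycles 0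
  have : Mono (F.map (K.iCycles 0).left) :=
    mono_map_iCycles (Comma.fst F (𝟭 B) ⋙ F) hK.acyclic (acyclic_map_fst hF hK) 0
  have : IsIso e.hom.left := inferInstanceAs (IsIso ((Comma.fst F (𝟭 B)).map e.hom))
  have : Mono (F.map i.left) := by
    have hi : F.map i.left = F.map e.hom.left ≫ F.map (K.iCycles 0).left := F.map_comp _ _
    rw [hi]
    infer_instance
  have : Mono (str (K.X 0)) := by
    have := hK.projective 0
    obtain ⟨r, hr⟩ := exists_retraction_of_projective (K.X 0)
    exact (SplitMono.mk r hr).mono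
  have : Mono (str W ≫ i.right) := by
    rw [← str_naturality]
    infer_instance
  exact mono_of_mono (str W) i.right

end GorensteinProjectives

section Copresentations

variable {A : Type u₁} [Category.{v₁} A] [Abelian A] {B : Type u₂} [Category.{v₂} B] [Abelian B]
  {F : A ⥤ B} [F.Additive] [PreservesFiniteColimits F]

lemma IsProjectiveCopresentation.GP (hF : PreservesAcyclicProjectives F)
    (hF' : PreservesCompleteResolutions F) {W : LeftComma F}
    (hW : IsProjectiveCopresentation F W) : GP (LeftComma F) W :=
  have := hW.2.1
  GP_of_components hF hF' W hW.1 hW.2.2.2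

lemma exists_copresentation (hF' : PreservesCompleteResolutions F) (Y : A) (hY : GP A Y) :
    ∃ (P : B) (φ : F.obj Y ⟶ P),
      IsProjectiveCopresentation F { left := Y, right := P, hom := φ } := by
  obtain ⟨P, ι, h₁, h₂, h₃⟩ := GP.exists_embedding (hF'.GP_obj Y hY)
  exact ⟨P, ι, hY, h₂, h₁, h₃⟩

lemma exists_extension_of_GP (hF : PreservesAcyclicProjectives F) {W : LeftComma F}
    (hW : GP (LeftComma F) W) {P : B} [Projective P] (f : F.obj W.left ⟶ P) :
    ∃ g : W.right ⟶ P, str W ≫ g = f :=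
  have := mono_hom_of_GP hF hW
  GP.exists_extension (shortComplex_mk_cokernel_shortExact (str W))
    ((coker_preservesCompleteResolutions hF).GP_obj W hW) f

lemma exists_factorization_of_left (hF : PreservesAcyclicProjectives F)
    (hF' : PreservesCompleteResolutions F) {W W' : LeftComma F} (hW : GP (LeftComma F) W)
    [Projective W'.right] (d : W ⟶ W') {Q : A} [Projective Q] (a : W.left ⟶ Q)
    (b : Q ⟶ W'.left) (hd : d.left = a ≫ b) :
    ∃ (α : W ⟶ (freeFunctor F).obj Q ⊞ (zeroLeftFunctor F).obj W'.right)
      (β : (freeFunctor F).obj Q ⊞ (zeroLeftFunctor F).obj W'.right ⟶ W'), d = α ≫ β := by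
  have := hF'.projective_obj Q
  obtain ⟨c, hc⟩ := exists_extension_of_GP hF hW (F.map a)
  let α : W ⟶ (freeFunctor F).obj Q := commaHom a c ((Category.comp_id _).trans hc.symm)
  let β : (freeFunctor F).obj Q ⟶ W' :=
    commaHom b (F.map b ≫ str W') (Category.id_comp _).symm
  have h : str W ≫ (d.right - c ≫ F.map b ≫ str W') = 0 := by
    rw [Preadditive.comp_sub, ← str_naturality, hd, reassoc_of% hc, F.map_comp, Category.assoc,
      sub_self]
  let γ : W ⟶ (zeroLeftFunctor F).obj W'.right :=
    commaHom 0 (d.right - c ≫ F.map b ≫ str W')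
      (((congrArg (· ≫ _) (F.map_zero _ _)).trans zero_comp).trans h.symm)
  refine ⟨biprod.lift α γ, biprod.desc β (fromZeroLeft W' (𝟙 _)), ?_⟩
  rw [biprod.lift_desc]
  ext
  · refine hd.trans (Eq.trans ?_ (congrArg (a ≫ b + ·) zero_comp.symm))
    exact (add_zero _).symm
  · change d.right = c ≫ F.map b ≫ str W' + (d.right - c ≫ F.map b ≫ str W') ≫ 𝟙 _
    rw [Category.comp_id, add_sub_cancel]

variable (hF : PreservesAcyclicProjectives F) (hF' : PreservesCompleteResolutions F)

/-- The functor `j^*`. -/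
abbrev stableFst : StableGP (LeftComma F) ⥤ StableGP A :=
  (fst_preservesCompleteResolutions hF hF').stableMap

lemma stableFst_surjective {W W' : (GP (LeftComma F)).FullSubcategory}
    (hW' : IsProjectiveCopresentation F W'.obj) :
    Function.Surjective (fun g : (toStable _).obj W ⟶ (toStable _).obj W' =>
      (stableFst hF hF').map g) := by
  intro f
  obtain ⟨f, rfl⟩ := (toStable A).map_surjective f
  let f' : W.obj.left ⟶ W'.obj.left := f.hom
  have := hW'.2.2.1
  obtain ⟨g, hg⟩ := exists_extension_of_GP hF W.property (F.map f' ≫ str W'.obj)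
  exact ⟨(toStable _).map (ObjectProperty.homMk (commaHom f' g hg.symm)), rfl⟩

lemma stableFst_injective {W W' : (GP (LeftComma F)).FullSubcategory}
    (hW' : IsProjectiveCopresentation F W'.obj) :
    Function.Injective (fun g : (toStable _).obj W ⟶ (toStable _).obj W' =>
      (stableFst hF hF').map g) := by
  intro f g hfg
  obtain ⟨f, rfl⟩ := (toStable _).map_surjective f
  obtain ⟨g, rfl⟩ := (toStable _).map_surjective g
  obtain ⟨Q, hQ, a, b, hab⟩ : ∃ (Q : A) (_ : Projective Q) (a : W.obj.left ⟶ Q)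
      (b : Q ⟶ W'.obj.left), (f.hom - g.hom).left = a ≫ b := (toStable_map_eq_iff _ _).1 hfg
  have := hW'.2.2.1
  obtain ⟨α, β, h⟩ := exists_factorization_of_left hF hF' W.property (f.hom - g.hom) a b hab
  have := projective_free (F := F) Q
  have := projective_zeroLeft (F := F) W'.obj.right
  exact toStable_map_eq_of_factor f g α β h

lemma stableFst_bijective (W : StableGP (LeftComma F)) {W' : (GP (LeftComma F)).FullSubcategory}
    (hW' : IsProjectiveCopresentation F W'.obj) :
    Function.Bijective (fun g : W ⟶ (toStable _).obj W' => (stableFst hF hF').map g) :=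
  ⟨stableFst_injective hF hF' (W := W.as) hW', stableFst_surjective hF hF' (W := W.as) hW'⟩

/-- A chosen copresentation `(Y, P)` of a Gorenstein projective object `Y`. -/
def copresentation (Y : (GP A).FullSubcategory) :
    (IsProjectiveCopresentation F).FullSubcategory :=
  ⟨_, (exists_copresentation hF' Y.obj Y.property).choose_spec.choose_spec⟩

/-- A copresentation, as a Gorenstein projective object of the left comma category. -/
abbrev copresentationToGP :
    (IsProjectiveCopresentation F).FullSubcategory ⥤ (GP (LeftComma F)).FullSubcategory :=
  ObjectProperty.ιOfLE fun _ hW => hW.GP hF hF'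

/-- The bijection which exhibits a copresentation of `Y` as the value at `Y` of the right adjoint
of `stableFst`. -/
def copresentationEquiv (W : StableGP (LeftComma F)) (Y : StableGP A) :
    ((stableFst hF hF').obj W ⟶ Y) ≃
      (W ⟶ (toStable _).obj ((copresentationToGP hF hF').obj (copresentation hF' Y.as))) :=
  (Equiv.ofBijective (fun g : W ⟶ (toStable _).obj ((copresentationToGP hF hF').obj
      (copresentation hF' Y.as)) => ((stableFst hF hF').map g : (stableFst hF hF').obj W ⟶ Y))
    (stableFst_bijective hF hF' W (copresentation hF' Y.as).property)).symm

lemma copresentationEquiv_naturality (W' W : StableGP (LeftComma F)) (Y : StableGP A)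
    (f : W' ⟶ W) (g : (stableFst hF hF').obj W ⟶ Y) :
    copresentationEquiv hF hF' W' Y ((stableFst hF hF').map f ≫ g) =
      f ≫ copresentationEquiv hF hF' W Y g := by
  rw [← Equiv.eq_symm_apply]
  obtain ⟨g, rfl⟩ := (copresentationEquiv hF hF' W Y).symm.surjective g
  rw [Equiv.apply_symm_apply]
  exact ((stableFst hF hF').map_comp f g).symm

/-- The functor `j_*`. -/
def stableCopresentation : StableGP A ⥤ StableGP (LeftComma F) :=
  Adjunction.rightAdjointOfEquiv (copresentationEquiv hF hF')
    (copresentationEquiv_naturality hF hF')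

/-- The functor `j_*` is right adjoint to `j^*`. -/
def stableFstAdj : stableFst hF hF' ⊣ stableCopresentation hF hF' :=
  Adjunction.adjunctionOfEquivRight (copresentationEquiv hF hF')
    (copresentationEquiv_naturality hF hF')

lemma stableFstAdj_counit_app (Y : StableGP A) :
    (stableFstAdj hF hF').counit.app Y = 𝟙 Y :=
  (Adjunction.adjunctionOfEquivRight_counit_app _ _ Y).trans ((stableFst hF hF').map_id _)

instance isIso_stableFstAdj_counit : IsIso (stableFstAdj hF hF').counit := by
  have (Y : StableGP A) : IsIso ((stableFstAdj hF hF').counit.app Y) := by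
    rw [stableFstAdj_counit_app]
    exact inferInstanceAs (IsIso (𝟙 Y))
  exact NatIso.isIso_of_isIso_app _

lemma isIso_of_isIso_stableFst_map {W W' : (GP (LeftComma F)).FullSubcategory}
    (hW : IsProjectiveCopresentation F W.obj) (hW' : IsProjectiveCopresentation F W'.obj)
    (f : (toStable _).obj W ⟶ (toStable _).obj W') (hf : IsIso ((stableFst hF hF').map f)) :
    IsIso f := by
  refine (isIso_iff_yoneda_map_bijective f).2 fun T =>
    (Function.Bijective.of_comp_iff' (stableFst_bijective hF hF' T hW') _).1 ?_
  have h : (fun g : T ⟶ (toStable _).obj W' => (stableFst hF hF').map g) ∘ (· ≫ f) =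
      (· ≫ (stableFst hF hF').map f) ∘ fun g => (stableFst hF hF').map g :=
    funext fun g => (stableFst hF hF').map_comp g f
  rw [h]
  exact ((isIso_iff_yoneda_map_bijective _).1 inferInstance _).comp
    (stableFst_bijective hF hF' T hW)

lemma isIso_unit_of_isProjectiveCopresentation
    (W : (IsProjectiveCopresentation F).FullSubcategory) :
    IsIso ((stableFstAdj hF hF').unit.app ((toStable _).obj
      ((copresentationToGP hF hF').obj W))) := by
  let V : StableGP (LeftComma F) := (toStable _).obj ((copresentationToGP hF hF').obj W)
  have : IsIso (𝟙 ((stableFst hF hF').obj V)) := inferInstance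
  have h : IsIso ((stableFst hF hF').map ((stableFstAdj hF hF').unit.app V)) :=
    IsIso.of_isIso_fac_right ((stableFstAdj hF hF').left_triangle_components V)
  exact isIso_of_isIso_stableFst_map hF hF' (W := (copresentationToGP hF hF').obj W)
    (W' := (copresentationToGP hF hF').obj (copresentation hF' _)) W.property
    (copresentation hF' _).property ((stableFstAdj hF hF').unit.app V) h

lemma isGivenByCopresentations_stableCopresentation :
    IsGivenByCopresentations F (stableCopresentation hF hF') := by
  refine ⟨exists_copresentation hF', fun _ hW => hW.GP hF hF',
    ⟨(NatIso.ofComponents (fun W => ?_) ?_).symm⟩⟩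
  · have := isIso_unit_of_isProjectiveCopresentation hF hF' W
    exact @asIso _ _ _ _ _ this
  · intro W W' f
    exact (stableFstAdj hF hF').unit.naturality
      ((copresentationToGP hF hF' ⋙ toStable _).map f)

end Copresentations

section Triangles

lemma exists_distinguished_of_iso₂₃ {C : Type u} [Category.{v} C] [Preadditive C]
    [HasZeroObject C] [HasShift C ℤ] [∀ n : ℤ, (shiftFunctor C n).Additive] [Pretriangulated C]
    {X Y Z Y' Z' : C} {f : X ⟶ Y} {g : Y ⟶ Z} {h : Z ⟶ X⟦(1 : ℤ)⟧} {f' : X ⟶ Y'} {g' : Y' ⟶ Z'}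
    (hT : Triangle.mk f g h ∈ distTriang C) (e₂ : Y' ≅ Y) (e₃ : Z' ≅ Z)
    (hf : f' ≫ e₂.hom = f) (hg : g' ≫ e₃.hom = e₂.hom ≫ g) :
    ∃ h' : Z' ⟶ X⟦(1 : ℤ)⟧, Triangle.mk f' g' h' ∈ distTriang C :=
  ⟨e₃.hom ≫ h, isomorphic_distinguished _ hT _ (Triangle.isoMk
    (Triangle.mk f' g' (e₃.hom ≫ h)) (Triangle.mk f g h) (Iso.refl _) e₂ e₃
    (hf.trans (Category.id_comp f).symm) hg
    ((congrArg ((e₃.hom ≫ h) ≫ ·) (CategoryTheory.Functor.map_id _ _)).trans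
      (Category.comp_id _)))⟩

lemma shortExact_cokernel_comp {C : Type u} [Category.{v} C] [Abelian C] {X Y Z : C} (f : X ⟶ Y)
    (g : Y ⟶ Z) [Mono g] :
    ((kernelCokernelCompSequence f g).sc
      (kernelCokernelCompSequence_exact f g).toIsComplex 3).ShortExact where
  exact := (kernelCokernelCompSequence_exact f g).exact 3
  mono_f := ((kernelCokernelCompSequence_exact f g).exact 2).mono_g
    ((isZero_kernel_of_mono g).eq_of_src _ _)
  epi_g := inferInstanceAs (Epi ((kernelCokernelCompSequence f g).map' 4 5))

open scoped StableShift

variable {A : Type u₁} [Category.{v₁} A] [Abelian A] {B : Type u₂} [Category.{v₂} B] [Abelian B]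
  {F : A ⥤ B} [F.Additive] [PreservesFiniteColimits F]

section

variable (W : LeftComma F) {P : B} (ι : W.right ⟶ P)

/-- The object `(Y, P)` obtained from `(Y, X)` and a morphism `X ⟶ P`. -/
def pushRight : LeftComma F where
  left := W.left
  right := P
  hom := str W ≫ ι

/-- The canonical morphism to `pushRight`. -/
def toPushRight : W ⟶ pushRight W ι :=
  commaHom (𝟙 W.left) ι ((congrArg (· ≫ str (pushRight W ι)) (F.map_id W.left)).trans
    (Category.id_comp _))

variable {W} in
/-- The morphism from `pushRight` with given components. -/
def fromPushRight {V : LeftComma F} (a : W.left ⟶ V.left) (b : P ⟶ V.right)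
    (h : F.map a ≫ str V = str W ≫ ι ≫ b) : pushRight W ι ⟶ V :=
  commaHom (W := pushRight W ι) a b (h.trans (Category.assoc _ _ _).symm)

variable (P) in
/-- The retraction of the canonical morphism from `(Y, X)` to `(Y, X ⊞ P)`. -/
def fromPushRightInl : pushRight W (biprod.inl : W.right ⟶ W.right ⊞ P) ⟶ W :=
  fromPushRight biprod.inl (𝟙 W.left) biprod.fst (by
    rw [F.map_id, Category.id_comp, biprod.inl_fst, Category.comp_id])

/-- The sequence `(0, X) ⟶ (Y, X ⊞ P) ⟶ (Y, P)`. -/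
def pushRightSequence : ShortComplex (LeftComma F) where
  X₁ := (zeroLeftFunctor F).obj W.right
  X₂ := pushRight W (biprod.inl : W.right ⟶ W.right ⊞ P)
  X₃ := pushRight W ι
  f := fromZeroLeft (pushRight W biprod.inl) (biprod.lift (𝟙 W.right) ι)
  g := fromPushRight (V := pushRight W ι) biprod.inl (𝟙 W.left) (biprod.desc ι (-𝟙 P))
    ((congrArg (· ≫ str W ≫ ι) (F.map_id W.left)).trans ((Category.id_comp _).trans
      (congrArg (str W ≫ ·) (biprod.inl_desc ι (-𝟙 P)).symm)))
  zero := by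
    ext
    · exact (isZero_zero A).eq_of_src _ _
    · have h : biprod.lift (𝟙 W.right) ι ≫ biprod.desc ι (-𝟙 P) = 0 := by
        rw [biprod.lift_desc, Category.id_comp, Preadditive.comp_neg, Category.comp_id,
          add_neg_cancel]
      exact h

lemma pushRightSequence_shortExact : (pushRightSequence W ι).ShortExact := by
  refine shortExact_of_components ?_ ?_
  · exact
      { exact := (ShortComplex.exact_iff_mono _ ((isZero_zero A).eq_of_src _ _)).2
          (inferInstanceAs (Mono (𝟙 W.left)))
        mono_f := ⟨fun _ _ _ => (isZero_zero A).eq_of_tgt _ _⟩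
        epi_g := inferInstanceAs (Epi (𝟙 W.left)) }
  · have h : (biprod.fst : W.right ⊞ P ⟶ W.right) ≫ biprod.lift (𝟙 W.right) ι +
        biprod.desc ι (-𝟙 P) ≫ (-biprod.inr : P ⟶ W.right ⊞ P) = 𝟙 (W.right ⊞ P) := by
      ext <;> simp
    have h' : (-biprod.inr : P ⟶ W.right ⊞ P) ≫ biprod.desc ι (-𝟙 P) = 𝟙 P := by simp
    exact ShortComplex.Splitting.shortExact
      { r := (biprod.fst : W.right ⊞ P ⟶ W.right)
        s := (-biprod.inr : P ⟶ W.right ⊞ P)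
        f_r := biprod.lift_fst (𝟙 W.right) ι
        s_g := h'
        id := h }

end

/-- The stable isomorphism between `(Y, X)` and `(Y, X ⊞ P)` for `P` projective. -/
def pushRightInlIso (W : (GP (LeftComma F)).FullSubcategory) (P : B) [Projective P]
    (hU : GP (LeftComma F) (pushRight W.obj (biprod.inl : W.obj.right ⟶ W.obj.right ⊞ P))) :
    (toStable _).obj W ≅ (toStable _).obj ⟨_, hU⟩ :=
  have := projective_zeroLeft (F := F) P
  have h₀ : str W.obj ≫ (biprod.inl : _ ⟶ W.obj.right ⊞ P) ≫ biprod.snd = 0 := by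
    rw [biprod.inl_snd, comp_zero]
  have h₁ : 𝟙 W.obj.left ≫ 𝟙 W.obj.left + (0 : W.obj.left ⟶ 0) ≫ 0 = 𝟙 W.obj.left := by
    rw [Category.comp_id, zero_comp, add_zero]
  toStableIso (X := W) (Y := ⟨_, hU⟩) (ObjectProperty.homMk (toPushRight W.obj biprod.inl))
    (ObjectProperty.homMk (fromPushRightInl W.obj P))
    (by
      apply ObjectProperty.hom_ext
      ext
      · exact Category.comp_id (𝟙 W.obj.left)
      · exact biprod.inl_fst)
    (fromPushRight (V := (zeroLeftFunctor F).obj P) biprod.inl 0 biprod.snd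
      (comp_zero.trans h₀.symm))
    (fromZeroLeft _ biprod.inr) (by
      ext
      · exact h₁
      · exact biprod.total)

lemma exists_pushRight_copresentation (hF : PreservesAcyclicProjectives F)
    (hF' : PreservesCompleteResolutions F) {W : LeftComma F} (hW : GP (LeftComma F) W) :
    ∃ (P : B) (ι : W.right ⟶ P), Projective P ∧
      IsProjectiveCopresentation F (pushRight W ι) := by
  obtain ⟨P, ι', hP, hι, hG⟩ := GP.exists_embedding
    ((snd_preservesCompleteResolutions hF hF').GP_obj W hW)
  let ι : W.right ⟶ P := ι'
  have : Mono ι := hι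
  have := mono_hom_of_GP hF hW
  exact ⟨P, ι, hP, (fst_preservesCompleteResolutions hF hF').GP_obj W hW,
    inferInstanceAs (Mono (str W ≫ ι)), hP, GP.of_shortExact
      (shortExact_cokernel_comp (str W) ι)
      ((coker_preservesCompleteResolutions hF).GP_obj W hW) hG⟩

lemma exists_triangle_pushRight (W : (GP (LeftComma F)).FullSubcategory) {P : B} [Projective P]
    (ι : W.obj.right ⟶ P) (h₀ : GP (LeftComma F) ((zeroLeftFunctor F).obj W.obj.right))
    (hV : GP (LeftComma F) (pushRight W.obj ι)) :
    ∃ w : (toStable _).obj ⟨_, hV⟩ ⟶ ((toStable _).obj ⟨_, h₀⟩)⟦(1 : ℤ)⟧,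
      Triangle.mk ((toStable _).map (X := ⟨_, h₀⟩) (Y := W)
          (ObjectProperty.homMk (fromZeroLeft W.obj (𝟙 W.obj.right))))
        ((toStable _).map (X := W) (Y := ⟨_, hV⟩)
          (ObjectProperty.homMk (toPushRight W.obj ι))) w ∈ distTriang _ := by
  have hS := pushRightSequence_shortExact W.obj ι
  have hU := GP.of_shortExact hS h₀ hV
  let S : ShortComplex (GP (LeftComma F)).FullSubcategory :=
    { X₁ := ⟨_, h₀⟩
      X₂ := ⟨_, hU⟩
      X₃ := ⟨_, hV⟩
      f := ObjectProperty.homMk (pushRightSequence W.obj ι).f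
      g := ObjectProperty.homMk (pushRightSequence W.obj ι).g
      zero := ObjectProperty.hom_ext _ (pushRightSequence W.obj ι).zero }
  let e := pushRightInlIso W P hU
  have hf : S.f ≫ ObjectProperty.homMk (fromPushRightInl W.obj P) =
      ObjectProperty.homMk (fromZeroLeft W.obj (𝟙 W.obj.right)) := by
    apply ObjectProperty.hom_ext
    ext
    · exact (isZero_zero A).eq_of_src _ _
    · exact biprod.lift_fst _ _
  have hg : ObjectProperty.homMk (toPushRight W.obj biprod.inl) ≫ S.g =
      ObjectProperty.homMk (toPushRight W.obj ι) := by
    apply ObjectProperty.hom_ext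
    ext
    · exact Category.comp_id (𝟙 W.obj.left)
    · exact biprod.inl_desc _ _
  refine exists_distinguished_of_iso₂₃ (stableTriangle_distinguished S hS) e (Iso.refl _) ?_ ?_
  · exact e.eq_comp_inv.1
      ((congrArg (toStable _).map hf.symm).trans ((toStable _).map_comp _ _))
  · exact (Category.comp_id _).trans
      ((congrArg (toStable _).map hg.symm).trans ((toStable _).map_comp _ _))

end Triangles

section Recollement

open scoped StableShift

variable {A : Type u₁} [Category.{v₁} A] [Abelian A] {B : Type u₂} [Category.{v₂} B] [Abelian B]
  {F : A ⥤ B} [F.Additive] [PreservesFiniteColimits F] (hF : PreservesAcyclicProjectives F)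

/-- The functor `i^*`. -/
abbrev stableCoker : StableGP (LeftComma F) ⥤ StableGP B :=
  (coker_preservesCompleteResolutions hF).stableMap

/-- The functor `j_!`. -/
abbrev stableFree : StableGP A ⥤ StableGP (LeftComma F) :=
  (free_preservesCompleteResolutions hF).stableMap

variable (hF' : PreservesCompleteResolutions F)

/-- The functor `i_*`. -/
abbrev stableZeroLeft : StableGP B ⥤ StableGP (LeftComma F) :=
  (zeroLeft_preservesCompleteResolutions hF').stableMap

/-- The functor `i^!`. -/
abbrev stableSnd : StableGP (LeftComma F) ⥤ StableGP B :=
  (snd_preservesCompleteResolutions hF hF').stableMap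

/-- The adjunction `(i^*, i_*)`. -/
def stableCokerAdj : stableCoker hF ⊣ stableZeroLeft hF' :=
  (coker_preservesCompleteResolutions hF).stableAdjunction
    (zeroLeft_preservesCompleteResolutions hF') (cokerAdjZeroLeft F)

/-- The adjunction `(i_*, i^!)`. -/
def stableZeroLeftAdj : stableZeroLeft hF' ⊣ stableSnd hF hF' :=
  (zeroLeft_preservesCompleteResolutions hF').stableAdjunction
    (snd_preservesCompleteResolutions hF hF') (zeroLeftAdjSnd F)

/-- The adjunction `(j_!, j^*)`. -/
def stableFreeAdj : stableFree hF ⊣ stableFst hF hF' :=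
  (free_preservesCompleteResolutions hF).stableAdjunction
    (fst_preservesCompleteResolutions hF hF') (freeAdjFst F)

instance isIso_stableZeroLeftAdj_unit : IsIso (stableZeroLeftAdj hF hF').unit :=
  have (X : StableGP B) : IsIso ((stableZeroLeftAdj hF hF').unit.app X) :=
    inferInstanceAs (IsIso (𝟙 X))
  NatIso.isIso_of_isIso_app _

instance isIso_stableFreeAdj_unit : IsIso (stableFreeAdj hF hF').unit :=
  have (X : StableGP A) : IsIso ((stableFreeAdj hF hF').unit.app X) :=
    inferInstanceAs (IsIso (𝟙 X))
  NatIso.isIso_of_isIso_app _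

lemma isZero_stableFst_stableZeroLeft (X : StableGP B) :
    IsZero ((stableFst hF hF').obj ((stableZeroLeft hF').obj X)) := by
  have h : IsZero (⟨0, GP_of_isZero (isZero_zero A)⟩ : (GP A).FullSubcategory) :=
    (IsZero.iff_id_eq_zero _).2 (ObjectProperty.hom_ext _ ((isZero_zero A).eq_of_src _ _))
  exact (toStable A).map_isZero h

lemma exists_triangle_stableFree_stableZeroLeft (W : StableGP (LeftComma F)) :
    ∃ w : (stableZeroLeft hF').obj ((stableCoker hF).obj W) ⟶
        ((stableFree hF).obj ((stableFst hF hF').obj W))⟦(1 : ℤ)⟧,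
      Triangle.mk ((stableFreeAdj hF hF').counit.app W)
        ((stableCokerAdj hF hF').unit.app W) w ∈ distTriang _ := by
  have : Mono W.as.obj.hom := mono_hom_of_GP hF W.as.property
  let S : ShortComplex (GP (LeftComma F)).FullSubcategory :=
    { X₁ := ⟨_, (free_preservesCompleteResolutions hF).GP_obj _
        ((fst_preservesCompleteResolutions hF hF').GP_obj _ W.as.property)⟩
      X₂ := W.as
      X₃ := ⟨_, (zeroLeft_preservesCompleteResolutions hF').GP_obj _
        ((coker_preservesCompleteResolutions hF).GP_obj _ W.as.property)⟩
      f := ObjectProperty.homMk (strSequence W.as.obj).f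
      g := ObjectProperty.homMk (strSequence W.as.obj).g
      zero := ObjectProperty.hom_ext _ (strSequence W.as.obj).zero }
  have hS : (S.map (GP (LeftComma F)).ι).ShortExact := strSequence_shortExact W.as.obj
  exact ⟨connectingHom S hS, stableTriangle_distinguished S hS⟩

lemma exists_triangle_stableZeroLeft_stableCopresentation (W : StableGP (LeftComma F)) :
    ∃ w : (stableCopresentation hF hF').obj ((stableFst hF hF').obj W) ⟶
        ((stableZeroLeft hF').obj ((stableSnd hF hF').obj W))⟦(1 : ℤ)⟧,
      Triangle.mk ((stableZeroLeftAdj hF hF').counit.app W)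
        ((stableFstAdj hF hF').unit.app W) w ∈ distTriang _ := by
  obtain ⟨P, ι, _, hV⟩ := exists_pushRight_copresentation hF hF' W.as.property
  obtain ⟨_, hT⟩ := exists_triangle_pushRight W.as ι
    ((zeroLeft_preservesCompleteResolutions hF').GP_obj _
      ((snd_preservesCompleteResolutions hF hF').GP_obj _ W.as.property)) (hV.GP hF hF')
  let V : (GP (LeftComma F)).FullSubcategory := ⟨_, hV.GP hF hF'⟩
  let v : W ⟶ (toStable _).obj V :=
    (toStable _).map (X := W.as) (ObjectProperty.homMk (toPushRight W.as.obj ι))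
  have := isIso_unit_of_isProjectiveCopresentation hF hF' ⟨_, hV⟩
  let e : (toStable _).obj V ≅
      (stableCopresentation hF hF').obj ((stableFst hF hF').obj ((toStable _).obj V)) :=
    @asIso _ _ _ _ _ this
  have hv : v ≫ e.hom = (stableFstAdj hF hF').unit.app W :=
    ((stableFstAdj hF hF').unit.naturality v).trans ((congrArg
      ((stableFstAdj hF hF').unit.app W ≫ ·) ((stableCopresentation hF hF').map_id
        ((stableFst hF hF').obj W))).trans (Category.comp_id _))
  exact exists_distinguished_of_iso₂₃ hT (Iso.refl W) e.symm (Category.comp_id _)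
    ((e.comp_inv_eq.2 hv.symm).trans (Category.id_comp v).symm)

/-- The recollement of the stable category of the left comma category. -/
def stableRecollement : Recollement (StableGP B) (StableGP (LeftComma F)) (StableGP A) :=
  letI := (stableFstAdj hF hF').rightAdjointCommShift ℤ
  have := (stableFstAdj hF hF').commShift_of_leftAdjoint ℤ
  have hi := (stableZeroLeftAdj hF hF').fullyFaithfulLOfIsIsoUnit
  have hj := (stableFreeAdj hF hF').fullyFaithfulLOfIsIsoUnit
  have hj' := (stableFstAdj hF hF').fullyFaithfulROfIsIsoCounit
  { iUpperStar := stableCoker hF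
    iLowerStar := stableZeroLeft hF'
    iUpperShriek := stableSnd hF hF'
    jLowerShriek := stableFree hF
    jUpperStar := stableFst hF hF'
    jLowerStar := stableCopresentation hF hF'
    iUpperStar_isTriangulated := inferInstance
    iLowerStar_isTriangulated := inferInstance
    iUpperShriek_isTriangulated := inferInstance
    jLowerShriek_isTriangulated := inferInstance
    jUpperStar_isTriangulated := inferInstance
    jLowerStar_isTriangulated := (stableFstAdj hF hF').isTriangulated_rightAdjoint
    adjUpperStarI := stableCokerAdj hF hF'
    adjShriekI := stableZeroLeftAdj hF hF'
    adjShriekJ := stableFreeAdj hF hF'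
    adjUpperStarJ := stableFstAdj hF hF'
    iLowerStar_full := hi.full
    iLowerStar_faithful := hi.faithful
    jLowerShriek_full := hj.full
    jLowerShriek_faithful := hj.faithful
    jLowerStar_full := hj'.full
    jLowerStar_faithful := hj'.faithful
    jUpperStar_iLowerStar := isZero_stableFst_stableZeroLeft hF hF'
    triangle_jShriek_iStar := exists_triangle_stableFree_stableZeroLeft hF hF'
    triangle_iShriek_jStar := exists_triangle_stableZeroLeft_stableCopresentation hF hF' }

end Recollement

end GorensteinComma

end

theorem theorem4p7_general {A : Type u₁} [Category.{v₁} A] [Abelian A] {B : Type u₂}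
    [Category.{v₂} B] [Abelian B] (F : A ⥤ B) [F.Additive] [PreservesFiniteColimits F]
    (hF : PreservesAcyclicProjectives F) (hF' : PreservesCompleteResolutions F) :
    ∃ (_ : StableTriangulation A) (_ : StableTriangulation B)
      (_ : StableTriangulation (LeftComma F))
      (R : Recollement (StableGP B) (StableGP (LeftComma F)) (StableGP A)),
      IsInducedBy R.iUpperStar (cokerFunctor F) ∧
      IsInducedBy R.iLowerStar (zeroLeftFunctor F) ∧
      IsInducedBy R.iUpperShriek (Comma.snd F (𝟭 B)) ∧
      IsInducedBy R.jLowerShriek (freeFunctor F) ∧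
      IsInducedBy R.jUpperStar (Comma.fst F (𝟭 B)) ∧
      IsGivenByCopresentations F R.jLowerStar :=
  ⟨stableTriangulation A, stableTriangulation B, stableTriangulation (LeftComma F),
    stableRecollement hF hF',
    (coker_preservesCompleteResolutions hF).isInducedBy_stableMap,
    (zeroLeft_preservesCompleteResolutions hF').isInducedBy_stableMap,
    (snd_preservesCompleteResolutions hF hF').isInducedBy_stableMap,
    (free_preservesCompleteResolutions hF).isInducedBy_stableMap,
    (fst_preservesCompleteResolutions hF hF').isInducedBy_stableMap,
    isGivenByCopresentations_stableCopresentation hF hF'⟩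

theorem theorem4p7 {A : Type u₁} [Category.{v₁} A] [Abelian A] {B : Type u₂} [Category.{v₂} B]
    [Abelian B] (F : A ⥤ B) [F.Additive] [PreservesFiniteColimits F] (hF : IsPerfect F)
    (hproj : F.PreservesProjectiveObjects) (hB : IsGorenstein B) :
    ∃ (_ : StableTriangulation A) (_ : StableTriangulation B)
      (_ : StableTriangulation (LeftComma F))
      (R : Recollement (StableGP B) (StableGP (LeftComma F)) (StableGP A)),
      IsInducedBy R.iUpperStar (cokerFunctor F) ∧
      IsInducedBy R.iLowerStar (zeroLeftFunctor F) ∧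
      IsInducedBy R.iUpperShriek (Comma.snd F (𝟭 B)) ∧
      IsInducedBy R.jLowerShriek (freeFunctor F) ∧
      IsInducedBy R.jUpperStar (Comma.fst F (𝟭 B)) ∧
      IsGivenByCopresentations F R.jLowerStar :=
  theorem4p7_general F hF.acyclic_map (hF.preservesCompleteResolutions hproj hB)
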